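/- Let $S$ be a linear order with a finite family $\mathcal U$ of subsets of $S$ (colors), regarded as a structure in the language with $<$ and a unary predicate for each color. "Definable" means definable in this structure, with parameters unless otherwise specified. Let $\bar S$ be the set of definable $x\subseteq S$ that are closed downwards and contain their supremum whenever it exists in $S$, ordered by inclusion. It has a minimum and a maximum; $S$ embeds in it by $a\mapsto\{b\in S: b\le a\}$, and every definable subset of $S$ has a supremum and an infimum in $\bar S$. For a $\emptyset$-definable $U\subseteq S$ and $a\in\bar S$ put $U_-(a)=\sup\{x\in U:x<a\}$ and $U_+(a)=\inf\{x\in U: x>a\}$, computed in $\bar S$. For a set $\mathcal V$ of $\emptyset$-definable subsets of $S$ let $F(\mathcal V)$ be the set of finite compositions (the empty composition, i.e. the identity, included) of functions $U_+,U_-:\bar S\to\bar S$ with $U\in\mathcal V$. A collection $\mathcal A$ of sets refines a set $B$ if each $A\in\mathcal A$ is contained in $B$ or disjoint from $B$; it refines a collection of sets if it refines each of its members. A color refinement of $(S,\mathcal U)$ is a sequence $(\mathcal U_n)_{n\in\mathbb N}$ of finite partitions of $S$ into $\emptyset$-definable sets such that $\mathcal U_0$ refines $\mathcal U$, $\mathcal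 U_{n+1}$ refines $\mathcal U_n$, and for all $n$, all $F,G\in F(\bigcup_{k<n}\mathcal U_k)$ that are compositions of fewer than $n$ functions $U_\pm$ (with $U\in\bigcup_{k<n}\mathcal U_k$), and all $V\in\bigcup_{k<n}\mathcal U_k$, the partition $\mathcal U_n$ refines the sets $\{x\in S:F(x)<G(x)\}$ and $\{x\in S:F(x)\in S\text{ and }F(x)\in V\}$. Then a color refinement exists, and for every color refinement, with $\mathcal U^c=\bigcup_n\mathcal U_n$, the following hold. Below, $\pi,\pi'$ denote either a coordinate projection or a constant function equal to the minimum or the maximum of $\bar S$. 1. For every $n\ge 0$, every $\emptyset$-definable subset of $S^n$ is a Boolean combination of sets of the form $\{a\in S^n:\pi(a)\in U\}$ with $U\in\mathcal U^c$, and $\{a\in S^n:F\pi(a)<G\pi'(a)\}$ with $F,G\in F(\mathcal U^c)$. 2. For every finite tuple $b$ of elements of $S$, every $b$-definable $T\subseteq S^n$ and every $b$-definable family $\{D_a\}_{a\in T}$ of subsets of $S$, there is a finite partition of $T$ into $b$-definable sets such that on each piece $P$ there are finitely many expressions, each of the form $$\{x\in S: L\pi(a,b)<x<R\pi'(a,b),\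 x\in U\}\quad\text{or}\quad\{x\in S:E\pi(a,b)=x\}$$ with $L,R,E\in F(\mathcal U^c)$ and $U\in\mathcal U^c$, such that for all $a\in P$ the set $D_a$ is the disjoint union of the sets that these expressions define. 3. For every finite tuple $b$ of elements of $S$, every $X\subseteq S^n$ and every $b$-definable function $f:X\to S$, there is a finite partition of $X$ into $b$-definable sets such that on each piece there are $F\in F(\mathcal U^c)$ and $\pi$ with $f(a)=F(\pi(a,b))$ for all $a$ in the piece. -/

import Mathlib

namespace ColoredOrder

universe u v

open FirstOrder

/-- The relation symbols of the language of linear orders with colors indexed by `ι`: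
a unary symbol for each color and one binary symbol for the strict order. -/
inductive ColRel (ι : Type u) : ℕ → Type u
  | color (i : ι) : ColRel ι 1
  | lt : ColRel ι 2

/-- The language of colored linear orders; it has no function or constant symbols. -/
abbrev colLang (ι : Type u) : FirstOrder.Language.{0, u} where
  Functions _ := Empty
  Relations := ColRel ι

variable {ι : Type u} {S : Type v} [LinearOrder S]

/-- The first-order structure on the linear order `S` with colors `U i`. -/
@[reducible] def colStructure (U : ι → Set S) : (colLang ι).Structure S where
  funMap := fun f _ => nomatch f
  RelMap := fun r x =>
    match r, x with
    | ColRel.color i, x => x 0 ∈ U i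
    | ColRel.lt, x => x 0 < x 1

/-- `D ⊆ S ^ κ` is definable in `(S, U)` with parameters from `A`. -/
def Def (U : ι → Set S) (A : Set S) {κ : Type} (D : Set (κ → S)) : Prop :=
  letI := colStructure U
  A.Definable (colLang ι) D

/-- `X ⊆ S` is definable in `(S, U)` with parameters from `A`. -/
def Def₁ (U : ι → Set S) (A X : Set S) : Prop :=
  Def U A {p : Fin 1 → S | p 0 ∈ X}

/-! ### Definability of the sets used to build cuts -/

section definability

variable {U : ι → Set S} {A X Y : Set S}

theorem Def₁.mono {B : Set S} (h : Def₁ U A X) (hAB : A ⊆ B) : Def₁ U B X :=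
  letI := colStructure U
  Set.Definable.mono (L := colLang ι) h hAB

theorem Def₁.compl (h : Def₁ U A X) : Def₁ U A Xᶜ :=
  letI := colStructure U
  Set.Definable.compl (L := colLang ι) h

theorem Def₁.inter (h : Def₁ U A X) (h' : Def₁ U A Y) : Def₁ U A (X ∩ Y) :=
  letI := colStructure U
  Set.Definable.inter (L := colLang ι) h h'

theorem Def₁.univ : Def₁ U A Set.univ :=
  letI := colStructure U
  Set.definable_univ (L := colLang ι) (A := A)

theorem Def₁.empty : Def₁ U A ∅ :=
  letI := colStructure U
  Set.definable_empty (L := colLang ι) (A := A)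

theorem def_lt : Def U A {p : Fin 2 → S | p 0 < p 1} := by
  let _ := colStructure U
  refine ⟨((colLang ι).lhomWithConstants A).onFormula
    (FirstOrder.Language.Relations.formula (L := colLang ι) (α := Fin 2) (ColRel.lt : ColRel ι 2)
      (fun i => FirstOrder.Language.Term.var i)), ?_⟩
  ext p
  rw [Set.mem_ofPred_eq, Set.mem_ofPred_eq, FirstOrder.Language.LHom.realize_onFormula]
  exact Iff.rfl

theorem Def₁.below (h : Def₁ U A X) : Def₁ U A {x | ∃ y ∈ X, x < y} := by
  let _ := colStructure U
  have h1 : A.Definable (colLang ι) {p : Fin 2 → S | p 1 ∈ X} :=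
    Set.Definable.preimage_comp (L := colLang ι) (fun _ : Fin 1 => (1 : Fin 2)) h
  have h2 := (Set.Definable.inter (L := colLang ι) (def_lt (U := U) (A := A)) h1).image_comp
    (fun _ : Fin 1 => (0 : Fin 2))
  unfold Def₁ Def
  convert h2 using 1
  ext p
  constructor
  · rintro ⟨y, hy, hxy⟩
    refine ⟨![p 0, y], ⟨by simpa using hxy, by simpa using hy⟩, ?_⟩
    funext i
    fin_cases i
    rfl
  · rintro ⟨q, ⟨hq, hq'⟩, rfl⟩
    exact ⟨q 1, hq', hq⟩

theorem Def₁.above (h : Def₁ U A X) : Def₁ U A {x | ∃ y ∈ X, y < x} := by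
  let _ := colStructure U
  have h1 : A.Definable (colLang ι) {p : Fin 2 → S | p 0 ∈ X} :=
    Set.Definable.preimage_comp (L := colLang ι) (fun _ : Fin 1 => (0 : Fin 2)) h
  have h2 := (Set.Definable.inter (L := colLang ι) (def_lt (U := U) (A := A)) h1).image_comp
    (fun _ : Fin 1 => (1 : Fin 2))
  unfold Def₁ Def
  convert h2 using 1
  ext p
  constructor
  · rintro ⟨y, hy, hxy⟩
    refine ⟨![y, p 0], ⟨by simpa using hxy, by simpa using hy⟩, ?_⟩
    funext i
    fin_cases i
    rfl
  · rintro ⟨q, ⟨hq, hq'⟩, rfl⟩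
    exact ⟨q 0, hq', hq⟩

theorem Def₁.singleton {a : S} (ha : a ∈ A) : Def₁ U A {a} := by
  let _ := colStructure U
  refine ⟨Language.Term.equal (FirstOrder.Language.Term.var 0)
    (((colLang ι).con (⟨a, ha⟩ : A)).term), ?_⟩
  ext p
  simp

end definability

/-! ### The definable completion -/

/-- A definable cut of `(S, U)`: a definable (with parameters) initial segment that contains
its supremum whenever that supremum exists in `S`. -/
structure IsDefCut (U : ι → Set S) (x : Set S) : Prop where
  definable : Def₁ U Set.univ x
  isLowerSet : IsLowerSet x
  sup_mem : ∀ a, IsLUB x a → a ∈ x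

/-- The definable completion of `(S, U)`. As a subtype of `Set S` it is ordered by inclusion. -/
abbrev Completion (U : ι → Set S) : Type v := {x : Set S // IsDefCut U x}

variable (U : ι → Set S)

/-- The supremum of a definable subset of `S` in the completion. -/
def cutSup (X : Set S) (hX : Def₁ U Set.univ X) : Completion U :=
  ⟨{s | ∀ t, t < s → ∃ x ∈ X, t < x}, by
    refine ⟨?_, fun s s' h hs t ht => hs t (ht.trans_le h), ?_⟩
    · have h := (hX.below.compl.above).compl
      convert h using 1
      ext s
      simp only [Set.mem_ofPred_eq, Set.mem_compl_iff]
      grind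
    · intro a ha t hta
      obtain ⟨s, hs, hts, -⟩ := ha.exists_between hta
      exact hs t hts⟩

/-- The infimum of a definable subset of `S` in the completion. -/
def cutInf (X : Set S) (hX : Def₁ U Set.univ X) : Completion U :=
  ⟨lowerBounds X, by
    refine ⟨?_, fun s s' h hs x hx => h.trans (hs hx), ?_⟩
    · have h := hX.above.compl
      convert h using 1
      ext s
      simp only [Set.mem_ofPred_eq, Set.mem_compl_iff, lowerBounds]
      grind
    · intro a ha x hx
      exact ha.2 fun s hs => hs hx⟩

/-- The embedding of `S` in its completion, `a ↦ {b | b ≤ a}`. -/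
def toCut (a : S) : Completion U :=
  ⟨Set.Iic a, by
    refine ⟨?_, isLowerSet_Iic a, fun b hb => hb.2 fun _ h => h⟩
    have h := (Def₁.singleton (U := U) (Set.mem_univ a)).above.compl
    convert h using 1
    ext s
    simp⟩

theorem toCut_le_iff {a : S} {x : Completion U} : toCut U a ≤ x ↔ a ∈ x.1 :=
  ⟨fun h => h (Set.mem_Iic.2 le_rfl), fun h _ hb => x.2.isLowerSet hb h⟩

theorem toCut_lt_iff {a : S} {x : Completion U} :
    toCut U a < x ↔ ∃ y ∈ x.1, a < y := by
  constructor
  · intro h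
    obtain ⟨y, hy, hya⟩ := Set.exists_of_ssubset h
    exact ⟨y, hy, not_le.1 hya⟩
  · rintro ⟨y, hy, hay⟩
    refine lt_of_le_not_ge ((toCut_le_iff U).2 (x.2.isLowerSet hay.le hy)) fun h => ?_
    exact not_le.2 hay (h hy)

theorem lt_toCut_iff {a : S} {x : Completion U} : x < toCut U a ↔ a ∉ x.1 := by
  constructor
  · intro h ha
    exact not_le_of_gt h ((toCut_le_iff U).2 ha)
  · intro h
    refine lt_of_le_not_ge (fun y hy => ?_) fun h' => h ((toCut_le_iff U).1 h')
    exact (not_le.1 fun hay => h (x.2.isLowerSet hay hy)).le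

/-- `cutSup` is the least upper bound in the completion. -/
theorem isLUB_cutSup (X : Set S) (hX : Def₁ U Set.univ X) :
    IsLUB (toCut U '' X) (cutSup U X hX) := by
  constructor
  · rintro _ ⟨x, hx, rfl⟩
    exact (toCut_le_iff U).2 fun t ht => ⟨x, hx, ht⟩
  · intro y hy s hs
    by_contra hsy
    refine hsy (y.2.sup_mem s ⟨fun z hz => ?_, fun z hz => ?_⟩)
    · exact (not_le.1 fun h => hsy (y.2.isLowerSet h hz)).le
    · by_contra hzs
      obtain ⟨x, hx, hzx⟩ := hs z (not_le.1 hzs)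
      exact not_le.2 hzx (hz ((toCut_le_iff U).1 (hy ⟨x, hx, rfl⟩)))

/-- `cutInf` is the greatest lower bound in the completion. -/
theorem isGLB_cutInf (X : Set S) (hX : Def₁ U Set.univ X) :
    IsGLB (toCut U '' X) (cutInf U X hX) := by
  constructor
  · rintro _ ⟨x, hx, rfl⟩ s hs
    exact hs hx
  · intro y hy s hs x hx
    exact hy ⟨x, hx, rfl⟩ hs

/-- The completion has a minimum (the supremum of `∅`) and a maximum (the infimum of `∅`). -/
instance : BoundedOrder (Completion U) where
  bot := cutSup U ∅ Def₁.empty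
  bot_le y := (isLUB_cutSup U ∅ Def₁.empty).2 (by simp [upperBounds])
  top := cutInf U ∅ Def₁.empty
  le_top y := (isGLB_cutInf U ∅ Def₁.empty).2 (by simp [lowerBounds])

theorem def_lt_cut {V : Set S} (hV : Def₁ U ∅ V) (a : Completion U) :
    Def₁ U Set.univ {x | x ∈ V ∧ toCut U x < a} := by
  have h := (hV.mono (Set.empty_subset Set.univ)).inter a.2.definable.below
  convert h using 1
  ext x
  simp [toCut_lt_iff]

theorem def_gt_cut {V : Set S} (hV : Def₁ U ∅ V) (a : Completion U) :
    Def₁ U Set.univ {x | x ∈ V ∧ a < toCut U x} := by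
  have h := (hV.mono (Set.empty_subset Set.univ)).inter a.2.definable.compl
  convert h using 1
  ext x
  simp [lt_toCut_iff]

/-- `V₋(a) = sup {x ∈ V | x < a}`. -/
def cutMinus (V : Set S) (hV : Def₁ U ∅ V) (a : Completion U) : Completion U :=
  cutSup U {x | x ∈ V ∧ toCut U x < a} (def_lt_cut U hV a)

/-- `V₊(a) = inf {x ∈ V | x > a}`. -/
def cutPlus (V : Set S) (hV : Def₁ U ∅ V) (a : Completion U) : Completion U :=
  cutInf U {x | x ∈ V ∧ a < toCut U x} (def_gt_cut U hV a)

/-- `IsComp U 𝒱 k F`: the function `F` is a composition of `k` functions of the form `V₊`, `V₋`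
with `V ∈ 𝒱`; the empty composition is the identity. -/
inductive IsComp (𝒱 : Set (Set S)) : ℕ → (Completion U → Completion U) → Prop
  | id : IsComp 𝒱 0 id
  | minus {k : ℕ} {F : Completion U → Completion U} (V : Set S) (hV : V ∈ 𝒱)
      (hdef : Def₁ U ∅ V) (hF : IsComp 𝒱 k F) : IsComp 𝒱 (k + 1) (cutMinus U V hdef ∘ F)
  | plus {k : ℕ} {F : Completion U → Completion U} (V : Set S) (hV : V ∈ 𝒱)
      (hdef : Def₁ U ∅ V) (hF : IsComp 𝒱 k F) : IsComp 𝒱 (k + 1) (cutPlus U V hdef ∘ F)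

/-- The set `F(𝒱)` of all finite compositions of functions `V₊`, `V₋` with `V ∈ 𝒱`. -/
def cutFunctions (𝒱 : Set (Set S)) : Set (Completion U → Completion U) :=
  {F | ∃ k, IsComp U 𝒱 k F}

/-! ### Partitions and refined colors -/

/-- `𝒬` is a finite partition of `T` (into nonempty sets). -/
structure IsFinPartition {X : Type*} (𝒬 : Set (Set X)) (T : Set X) : Prop where
  finite : 𝒬.Finite
  nonempty : ∀ P ∈ 𝒬, P.Nonempty
  disjoint : 𝒬.PairwiseDisjoint _root_.id
  sUnion_eq : ⋃₀ 𝒬 = T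

/-- `𝒜` refines the set `B`. -/
def Refines {X : Type*} (𝒜 : Set (Set X)) (B : Set X) : Prop :=
  ∀ A ∈ 𝒜, A ⊆ B ∨ A ⊆ Bᶜ

/-- The colors of index less than `n`. -/
def colorsBelow (𝒰 : ℕ → Set (Set S)) (n : ℕ) : Set (Set S) := ⋃ k < n, 𝒰 k

/-- `𝒰 0, 𝒰 1, …` is a sequence of successively refined finite partitions of `S` into
`∅`-definable sets, starting from the colors `U`, which decide the conditions `F(x) < G(x)` and
`F(x) ∈ V`, for compositions of fewer than `n` cut functions with earlier colors, at stage `n`. -/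
structure IsColorRefinement (𝒰 : ℕ → Set (Set S)) : Prop where
  partition : ∀ n, IsFinPartition (𝒰 n) Set.univ
  definable : ∀ n, ∀ V ∈ 𝒰 n, Def₁ U ∅ V
  refines_colors : ∀ i, Refines (𝒰 0) (U i)
  refines_succ : ∀ n, ∀ V ∈ 𝒰 n, Refines (𝒰 (n + 1)) V
  refines_lt : ∀ n k l F G, k < n → l < n →
    IsComp U (colorsBelow 𝒰 n) k F → IsComp U (colorsBelow 𝒰 n) l G →
    Refines (𝒰 n) {x | F (toCut U x) < G (toCut U x)}
  refines_mem : ∀ n k F, k < n → IsComp U (colorsBelow 𝒰 n) k F →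
    ∀ V ∈ colorsBelow 𝒰 n, Refines (𝒰 n) {x | F (toCut U x) ∈ toCut U '' V}

/-- The set of all refined colors, `⋃ n, 𝒰 n`. -/
def allColors (𝒰 : ℕ → Set (Set S)) : Set (Set S) := ⋃ n, 𝒰 n

/-! ### Basic sets and cells -/

/-- A coordinate projection on `S ^ κ`, or one of the two constants. -/
inductive Proj (κ : Type)
  | coord (i : κ) : Proj κ
  | min : Proj κ
  | max : Proj κ

/-- The function from `S ^ κ` to the completion given by a coordinate projection or constant. -/
def Proj.eval {κ : Type} : Proj κ → (κ → S) → Completion U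
  | .coord i, a => toCut U (a i)
  | .min, _ => ⊥
  | .max, _ => ⊤

/-- The basic sets `{a | π(a) ∈ V}` and `{a | F(π(a)) < G(π'(a))}`. -/
def basicSets (𝒱 : Set (Set S)) (κ : Type) : Set (Set (κ → S)) :=
  {D | ∃ π : Proj κ, ∃ V ∈ 𝒱, D = {a | π.eval U a ∈ toCut U '' V}} ∪
  {D | ∃ F ∈ cutFunctions U 𝒱, ∃ G ∈ cutFunctions U 𝒱, ∃ π π' : Proj κ,
    D = {a | F (π.eval U a) < G (π'.eval U a)}}

/-- A family of subsets of `S`, with parameter in `S ^ κ`, of the form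
`c ↦ {x ∈ V | L(π(c)) < x < R(π'(c))}` or `c ↦ {x | E(π(c)) = x}`. -/
inductive IsCell (𝒱 : Set (Set S)) {κ : Type} : ((κ → S) → Set S) → Prop
  | interval {L R : Completion U → Completion U} (hL : L ∈ cutFunctions U 𝒱)
      (hR : R ∈ cutFunctions U 𝒱) (π π' : Proj κ) {V : Set S} (hV : V ∈ 𝒱) :
      IsCell 𝒱 fun c => {x | L (π.eval U c) < toCut U x ∧ toCut U x < R (π'.eval U c) ∧ x ∈ V}
  | point {E : Completion U → Completion U} (hE : E ∈ cutFunctions U 𝒱) (π : Proj κ) :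
      IsCell 𝒱 fun c => {x | E (π.eval U c) = toCut U x}

end ColoredOrder

open ColoredOrder

namespace ColoredOrder

open FirstOrder

universe u v

variable {ι : Type u} {S : Type v} [LinearOrder S] {U : ι → Set S}

/-! ### The completion as a linear order -/

/-! The proof is a back-and-forth argument with bounded depth. `Sim` at stage `n` compares finitely
many data of two tuples: the stage `n` colors of the coordinates and the order among the values of
compositions of length less than `n`. Up to such similarity there are only finitely many tuples, and
the classes are Boolean combinations of basic sets.

The heart is the extension step: if `a` and `c` are similar at stage `2 * n + 2`, each `x` has a
partner `y` such that the extended tuples are similar at stage `n`. It suffices that `x` and `y`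
share a stage `n` color and lie in the same position among the values of compositions of length at
most `2 * n` at `a` and at `c` (`SameCell`). Comparisons `F(x) < G(x)` are decided by the color of
`x`. In a comparison of `F(x)` with `G(π(a))` the functions of `F` are moved one at a time to the
other side, by the adjunction `V₊(y) < c ↔ y < V₋(c)`; its non-strict versions (`cutPlus_le_iff`,
`le_cutMinus_iff`) bring in conditions on `G(π(a))` alone, which similarity decides. A partner
exists because the position of `x` is a cell: a single value, or a color `P` between adjacent values
`L` and `R`, where nonemptiness says `P₊(L) < R`, again a comparison that similarity decides.

Induction on formulas then shows that every definable set is a union of similarity classes, which is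
quantifier elimination. On each class over the parameters, a definable family is a union of the same
finitely many cells. The value of a definable function is a singleton cell, hence the value of one
composition. -/

noncomputable instance : LinearOrder (Completion U) where
  le_total x y := x.2.isLowerSet.total y.2.isLowerSet
  toDecidableLE := Classical.decRel _

theorem toCut_le_toCut {a b : S} : toCut U a ≤ toCut U b ↔ a ≤ b :=
  (toCut_le_iff U).trans Set.mem_Iic

theorem toCut_lt_toCut {a b : S} : toCut U a < toCut U b ↔ a < b :=
  (lt_toCut_iff U).trans (by simp [toCut])

theorem toCut_injective : Function.Injective (toCut U) := fun _ _ h =>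
  le_antisymm (toCut_le_toCut.1 h.le) (toCut_le_toCut.1 h.ge)

theorem mem_image_toCut {V : Set S} {a : S} : toCut U a ∈ toCut U '' V ↔ a ∈ V :=
  toCut_injective.mem_set_image

/-! ### Comparing values of cut functions -/

section cut

variable {V : Set S} (hV : Def₁ U ∅ V) {c y : Completion U}

theorem lt_cutMinus_iff :
    c < cutMinus U V hV y ↔ ∃ u ∈ V, c < toCut U u ∧ toCut U u < y := by
  rw [cutMinus, lt_isLUB_iff (isLUB_cutSup U _ _)]
  simp only [Set.exists_mem_image, Set.mem_ofPred_eq]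
  grind

theorem cutPlus_lt_iff :
    cutPlus U V hV y < c ↔ ∃ u ∈ V, y < toCut U u ∧ toCut U u < c := by
  rw [cutPlus, isGLB_lt_iff (isGLB_cutInf U _ _)]
  simp only [Set.exists_mem_image, Set.mem_ofPred_eq]
  grind

/-- Both sides say that a point of `V` lies strictly between `y` and `c`. -/
theorem cutPlus_lt_iff_lt_cutMinus : cutPlus U V hV y < c ↔ y < cutMinus U V hV c := by
  rw [lt_cutMinus_iff, cutPlus_lt_iff]

theorem le_cutPlus : y ≤ cutPlus U V hV y := by
  rw [← not_lt, cutPlus_lt_iff]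
  rintro ⟨u, -, h, h'⟩
  exact h.not_gt h'

theorem cutMinus_le : cutMinus U V hV y ≤ y := by
  rw [← not_lt, lt_cutMinus_iff]
  rintro ⟨u, -, h, h'⟩
  exact h.not_gt h'

theorem cutPlus_le {u : S} (hu : u ∈ V) (h : y < toCut U u) : cutPlus U V hV y ≤ toCut U u :=
  (isGLB_cutInf U _ _).1 ⟨u, ⟨hu, h⟩, rfl⟩

theorem le_cutMinus {u : S} (hu : u ∈ V) (h : toCut U u < y) : toCut U u ≤ cutMinus U V hV y :=
  (isLUB_cutSup U _ _).1 ⟨u, ⟨hu, h⟩, rfl⟩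

/-- Suppose `y < c`. If no point of `V` lies in the interval from `y` (excluded) to `c` (included),
the infimum can be at most `c` only if points of `V` accumulate at `c` from above. On the right, `y`
is compared only with `c` and `V₋(c)`; everything else concerns `c` alone. -/
theorem cutPlus_le_iff : cutPlus U V hV y ≤ c ↔
    y < cutMinus U V hV c ∨ (c ∈ toCut U '' V ∧ y < c) ∨ (cutPlus U V hV c ≤ c ∧ y ≤ c) := by
  constructor
  · intro h
    have hyc := (le_cutPlus hV).trans h
    rcases hyc.eq_or_lt with rfl | hlt
    · exact Or.inr (Or.inr ⟨h, le_rfl⟩)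
    · by_contra! hn
      obtain ⟨h1, h2, h3⟩ := hn
      have h3 := fun hc => (h3 hc).not_ge hyc
      rw [imp_false, not_le, ← not_le] at h3
      refine h3 (le_of_forall_gt fun d hd => ?_)
      obtain ⟨u, hu, hyu, hud⟩ := (cutPlus_lt_iff hV).1 (h.trans_lt hd)
      refine (cutPlus_lt_iff hV).2 ⟨u, hu, ?_, hud⟩
      by_contra! huc
      rcases huc.eq_or_lt with rfl | huc
      · exact (h2 ⟨u, hu, rfl⟩).not_gt hlt
      · exact h1.not_gt ((lt_cutMinus_iff hV).2 ⟨u, hu, hyu, huc⟩)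
  · rintro (h | ⟨⟨u, hu, rfl⟩, h⟩ | ⟨h, h'⟩)
    · exact ((cutPlus_lt_iff_lt_cutMinus hV).2 h).le
    · exact cutPlus_le hV hu h
    · refine le_trans (le_of_forall_gt fun d hd => ?_) h
      obtain ⟨u, hu, hyu, hud⟩ := (cutPlus_lt_iff hV).1 hd
      exact (cutPlus_lt_iff hV).2 ⟨u, hu, h'.trans_lt hyu, hud⟩

theorem le_cutMinus_iff : c ≤ cutMinus U V hV y ↔
    cutPlus U V hV c < y ∨ (c ∈ toCut U '' V ∧ c < y) ∨ (c ≤ cutMinus U V hV c ∧ c ≤ y) := by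
  constructor
  · intro h
    have hyc := h.trans (cutMinus_le hV)
    rcases hyc.eq_or_lt with rfl | hlt
    · exact Or.inr (Or.inr ⟨h, le_rfl⟩)
    · by_contra! hn
      obtain ⟨h1, h2, h3⟩ := hn
      have h3 := fun hc => (h3 hc).not_ge hyc
      rw [imp_false, not_le, ← not_le] at h3
      refine h3 (le_of_forall_lt fun d hd => ?_)
      obtain ⟨u, hu, hyu, hud⟩ := (lt_cutMinus_iff hV).1 (hd.trans_le h)
      refine (lt_cutMinus_iff hV).2 ⟨u, hu, hyu, ?_⟩
      by_contra! huc
      rcases huc.eq_or_lt with rfl | huc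
      · exact (h2 ⟨u, hu, rfl⟩).not_gt hlt
      · exact h1.not_gt ((cutPlus_lt_iff hV).2 ⟨u, hu, huc, hud⟩)
  · rintro (h | ⟨⟨u, hu, rfl⟩, h⟩ | ⟨h, h'⟩)
    · exact ((cutPlus_lt_iff_lt_cutMinus hV).1 h).le
    · exact le_cutMinus hV hu h
    · refine h.trans (le_of_forall_lt fun d hd => ?_)
      obtain ⟨u, hu, hyu, hud⟩ := (lt_cutMinus_iff hV).1 hd
      exact (lt_cutMinus_iff hV).2 ⟨u, hu, hyu, hud.trans_le h'⟩

end cut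

/-! ### Definability -/

section definability

variable {A : Set S} {κ κ' : Type}

theorem Def.not {p : (κ → S) → Prop} (h : Def U A {v | p v}) : Def U A {v | ¬ p v} :=
  letI := colStructure U
  Set.Definable.compl (L := colLang ι) h

theorem Def.and {p q : (κ → S) → Prop} (h : Def U A {v | p v}) (h' : Def U A {v | q v}) :
    Def U A {v | p v ∧ q v} :=
  letI := colStructure U
  Set.Definable.inter (L := colLang ι) h h'

theorem Def.reindex {p : (κ → S) → Prop} (h : Def U A {v | p v}) (f : κ → κ') :
    Def U A {v | p (v ∘ f)} :=
  letI := colStructure U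
  Set.Definable.preimage_comp (L := colLang ι) f h

/-- The quantified variable is the entry at `none`; quantifying over it is projecting along `some`.
-/
theorem Def.ex [Finite κ] {p : S → (κ → S) → Prop}
    (h : Def U A {w : Option κ → S | p (w none) (w ∘ some)}) :
    Def U A {v | ∃ x, p x v} := by
  let _ := colStructure U
  have h1 := Set.Definable.image_comp (L := colLang ι) h (some : κ → Option κ)
  unfold Def
  convert h1 using 1
  ext v
  constructor
  · rintro ⟨x, hx⟩
    exact ⟨fun o => o.elim x v, hx, rfl⟩
  · rintro ⟨w, hw, rfl⟩
    exact ⟨w none, hw⟩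

theorem Def.lt (i j : κ) : Def U A {v : κ → S | v i < v j} :=
  (def_lt (U := U) (A := A)).reindex ![i, j]

theorem Def₁.coord {X : Set S} (h : Def₁ U A X) (i : κ) : Def U A {v : κ → S | v i ∈ X} :=
  Def.reindex (p := fun p : Fin 1 → S => p 0 ∈ X) h fun _ => i

theorem def₁_color (i : ι) : Def₁ U A (U i) := by
  let _ := colStructure U
  refine ⟨((colLang ι).lhomWithConstants A).onFormula
    (FirstOrder.Language.Relations.formula (L := colLang ι) (α := Fin 1)
      (ColRel.color i : ColRel ι 1) (fun i => FirstOrder.Language.Term.var i)), ?_⟩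
  ext p
  rw [Set.mem_ofPred_eq, Set.mem_ofPred_eq, FirstOrder.Language.LHom.realize_onFormula]
  exact Iff.rfl

/-- A family of elements of the completion, with parameter in `S ^ κ`, is `∅`-definable. -/
def DefFamily (c : (κ → S) → Completion U) : Prop :=
  Def U ∅ {w : Option κ → S | w none ∈ (c (w ∘ some)).1}

theorem DefFamily.mem {c : (κ → S) → Completion U} (h : DefFamily c) (i : κ') (f : κ → κ') :
    Def U ∅ {v : κ' → S | v i ∈ (c (v ∘ f)).1} :=
  Def.reindex (p := fun w : Option κ → S => w none ∈ (c (w ∘ some)).1) h fun o => o.elim i f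

theorem DefFamily.reindex {c : (κ → S) → Completion U} (h : DefFamily c) (f : κ → κ') :
    DefFamily fun v : κ' → S => c (v ∘ f) :=
  h.mem none (some ∘ f)

theorem DefFamily.coord (i : κ) : DefFamily fun v : κ → S => toCut U (v i) := by
  have h := (Def.lt (U := U) (A := ∅) (some i) (none : Option κ)).not
  simpa [DefFamily, toCut] using h

theorem DefFamily.bot_top {c : Completion U} (hc : c = ⊥ ∨ c = ⊤) :
    DefFamily fun _ : κ → S => c := by
  have key : Def₁ U ∅ c.1 := by
    rcases hc with rfl | rfl
    -- The cut `⊥` need not be empty: it contains the least element of `S` if there is one.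
    · have h := (((Def₁.empty (U := U) (A := ∅)).below).compl.above).compl
      convert h using 1
      ext s
      simp [Bot.bot, cutSup]
    · have h := (Def₁.empty (U := U) (A := ∅)).above.compl
      convert h using 1
      ext s
      simp [Top.top, cutInf]
  exact key.coord none

theorem DefFamily.lt [Finite κ] {c d : (κ → S) → Completion U} (hc : DefFamily c)
    (hd : DefFamily d) : Def U ∅ {v | c v < d v} := by
  have h := Def.ex (p := fun x v => x ∈ (d v).1 ∧ ¬ x ∈ (c v).1) (Def.and hd (Def.not hc))
  refine (congrArg (Def U ∅) ?_).mp h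
  ext v
  rw [Set.mem_ofPred_eq, Set.mem_ofPred_eq, ← not_le]
  exact Set.not_subset.symm

theorem DefFamily.cutMinus [Finite κ] {c : (κ → S) → Completion U} (hc : DefFamily c) {V : Set S}
    (hV : Def₁ U ∅ V) : DefFamily fun v => cutMinus U V hV (c v) := by
  -- This is the condition defining `cutSup`, with its universal quantifier written as a negated
  -- existential one.
  have h := Def.not (Def.ex (κ := Option κ) (p := fun t w => t < w none ∧
    ¬ ∃ x, (x ∈ V ∧ toCut U x < c (w ∘ some)) ∧ t < x) (U := U) (A := ∅) ((Def.lt _ _).and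
      (Def.not (Def.ex (κ := Option (Option κ)) (p := fun x w =>
        (x ∈ V ∧ toCut U x < c (w ∘ some ∘ some)) ∧ w none < x)
        (((hV.coord _).and ((DefFamily.coord none).lt (hc.reindex (some ∘ some ∘ some)))).and
          (Def.lt _ _))))))
  refine (congrArg (Def U ∅) ?_).mp h
  ext w
  simp [ColoredOrder.cutMinus, cutSup, and_assoc]

theorem DefFamily.cutPlus [Finite κ] {c : (κ → S) → Completion U} (hc : DefFamily c) {V : Set S}
    (hV : Def₁ U ∅ V) : DefFamily fun v => cutPlus U V hV (c v) := by
  have h := Def.not (Def.ex (κ := Option κ) (p := fun x w => (x ∈ V ∧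
    c (w ∘ some) < toCut U x) ∧ x < w none) (U := U) (A := ∅) (((hV.coord _).and
      ((hc.reindex (some ∘ some)).lt (DefFamily.coord none))).and (Def.lt _ _)))
  refine (congrArg (Def U ∅) ?_).mp h
  ext w
  simp [ColoredOrder.cutPlus, cutInf, lowerBounds]

theorem DefFamily.comp [Finite κ] {c : (κ → S) → Completion U} (hc : DefFamily c)
    {𝒱 : Set (Set S)} {k : ℕ} {F : Completion U → Completion U} (hF : IsComp U 𝒱 k F) :
    DefFamily fun v => F (c v) := by
  induction hF with
  | id => exact hc
  | minus V _ hdef _ ih => exact ih.cutMinus hdef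
  | plus V _ hdef _ ih => exact ih.cutPlus hdef

theorem DefFamily.proj (π : Proj κ) : DefFamily (π.eval U) := by
  cases π with
  | coord i => exact DefFamily.coord i
  | min => exact DefFamily.bot_top (Or.inl rfl)
  | max => exact DefFamily.bot_top (Or.inr rfl)

theorem DefFamily.mem_image [Finite κ] {c : (κ → S) → Completion U} (hc : DefFamily c) {V : Set S}
    (hV : Def₁ U ∅ V) : Def U ∅ {v | c v ∈ toCut U '' V} := by
  have h := Def.ex (κ := κ) (p := fun x v => x ∈ V ∧ ¬ toCut U x < c v ∧ ¬ c v < toCut U x)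
    (U := U) (A := ∅) ((hV.coord _).and
      (((DefFamily.coord none).lt (hc.reindex some)).not.and
        ((hc.reindex some).lt (DefFamily.coord none)).not))
  refine (congrArg (Def U ∅) ?_).mp h
  ext v
  simp only [Set.mem_image, not_lt, Set.mem_ofPred_eq]
  exact exists_congr fun x => and_congr_right fun _ =>
    ⟨fun h => le_antisymm h.2 h.1, fun h => ⟨h.ge, h.le⟩⟩

end definability

/-! ### Atoms of a finite family of sets -/

section atoms

variable {X : Type*} {ℬ : Set (Set X)}

/-- A set whose elements are decided by a finite family is a Boolean combination of it. -/
theorem mem_closure_of_determined (hℬ : ℬ.Finite) {D : Set X}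
    (h : ∀ a a', (∀ B ∈ ℬ, a ∈ B ↔ a' ∈ B) → a ∈ D → a' ∈ D) :
    D ∈ BooleanSubalgebra.closure ℬ := by
  induction ℬ, hℬ using Set.Finite.induction_on generalizing D with
  | empty =>
    rcases D.eq_empty_or_nonempty with rfl | ⟨a, ha⟩
    · exact BooleanSubalgebra.bot_mem
    · rw [Set.eq_univ_of_forall fun a' => h a a' (by simp) ha]
      exact BooleanSubalgebra.top_mem
  | @insert B ℬ _ _ ih =>
    -- The saturation of `D ∩ E` under the smaller family is covered by induction. Cutting the
    -- saturations for `E = B` and `E = Bᶜ` back to `B` and `Bᶜ` recovers `D`.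
    have key : ∀ E : Set X, {a | ∃ a' ∈ D ∩ E, ∀ C ∈ ℬ, a' ∈ C ↔ a ∈ C} ∈
        BooleanSubalgebra.closure (insert B ℬ) := fun E =>
      BooleanSubalgebra.closure_mono (Set.subset_insert B ℬ) <| ih fun a a' haa' ⟨a₀, ha₀, h₀⟩ =>
        ⟨a₀, ha₀, fun C hC => (h₀ C hC).trans (haa' C hC)⟩
    have hB : B ∈ BooleanSubalgebra.closure (insert B ℬ) :=
      BooleanSubalgebra.subset_closure (Set.mem_insert B ℬ)
    have := BooleanSubalgebra.sup_mem (BooleanSubalgebra.inf_mem (key B) hB)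
      (BooleanSubalgebra.inf_mem (key Bᶜ) (BooleanSubalgebra.compl_mem hB))
    convert this using 1
    ext a
    constructor
    · intro ha
      by_cases haB : a ∈ B
      · exact Or.inl ⟨⟨a, ⟨ha, haB⟩, fun _ _ => Iff.rfl⟩, haB⟩
      · exact Or.inr ⟨⟨a, ⟨ha, haB⟩, fun _ _ => Iff.rfl⟩, haB⟩
    · rintro (⟨⟨a', ⟨ha', hB'⟩, h'⟩, haB⟩ | ⟨⟨a', ⟨ha', hB'⟩, h'⟩, haB⟩) <;>
      · refine h a' a (fun C hC => ?_) ha'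
        rcases hC with rfl | hC
        · first | exact iff_of_true hB' haB | exact iff_of_false hB' haB
        · exact h' C hC

/-- The points that belong to the same members of `ℬ` as `x`. -/
def atom (ℬ : Set (Set X)) (x : X) : Set X := {y | ∀ B ∈ ℬ, x ∈ B ↔ y ∈ B}

theorem mem_atom_self (x : X) : x ∈ atom ℬ x := fun _ _ => Iff.rfl

theorem atom_eq_of_mem {x y : X} (h : y ∈ atom ℬ x) : atom ℬ x = atom ℬ y := by
  ext z
  exact forall₂_congr fun B hB => by rw [h B hB]

/-- An atom is determined by the subfamily of members of `ℬ` that contain it. -/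
theorem finite_range_atom (hℬ : ℬ.Finite) : (Set.range (atom ℬ)).Finite := by
  refine (hℬ.powerset.image fun 𝒞 : Set (Set X) => {y | ∀ B ∈ ℬ, B ∈ 𝒞 ↔ y ∈ B}).subset ?_
  rintro _ ⟨x, rfl⟩
  refine ⟨{B ∈ ℬ | x ∈ B}, fun B hB => hB.1, ?_⟩
  ext y
  exact forall₂_congr fun B hB => by simp [hB]

theorem isFinPartition_atoms (hℬ : ℬ.Finite) {T : Set X} (hT : ∀ x ∈ T, atom ℬ x ⊆ T) :
    IsFinPartition (atom ℬ '' T) T where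
  finite := (finite_range_atom hℬ).subset (Set.image_subset_range _ _)
  nonempty := by
    rintro _ ⟨x, -, rfl⟩
    exact ⟨x, mem_atom_self x⟩
  disjoint := by
    rintro _ ⟨x, -, rfl⟩ _ ⟨y, -, rfl⟩ hne
    refine Set.disjoint_left.2 fun z hz hz' => hne ?_
    rw [atom_eq_of_mem hz, atom_eq_of_mem hz']
  sUnion_eq := by
    ext x
    constructor
    · rintro ⟨_, ⟨y, hy, rfl⟩, hx⟩
      exact hT y hy hx
    · exact fun hx => ⟨_, ⟨x, hx, rfl⟩, mem_atom_self x⟩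

theorem refines_atoms {B : Set X} (hB : B ∈ ℬ) (T : Set X) : Refines (atom ℬ '' T) B := by
  rintro _ ⟨x, -, rfl⟩
  by_cases hx : x ∈ B
  · exact Or.inl fun y hy => (hy B hB).1 hx
  · exact Or.inr fun y hy hyB => hx ((hy B hB).2 hyB)

theorem atom_mem_closure (hℬ : ℬ.Finite) (x : X) : atom ℬ x ∈ BooleanSubalgebra.closure ℬ :=
  mem_closure_of_determined hℬ fun _ _ h ha B hB => (ha B hB).trans (h B hB)

end atoms

/-! ### Definability of atoms -/

theorem def_of_mem_closure {A : Set S} {κ : Type} {ℬ : Set (Set (κ → S))}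
    (h : ∀ B ∈ ℬ, Def U A B) {D : Set (κ → S)} (hD : D ∈ BooleanSubalgebra.closure ℬ) :
    Def U A D := by
  let _ := colStructure U
  let K : BooleanSubalgebra (Set (κ → S)) :=
    { carrier := {D | Def U A D}
      supClosed' := fun _ hD _ hE => Set.Definable.union (L := colLang ι) hD hE
      infClosed' := fun _ hD _ hE => Set.Definable.inter (L := colLang ι) hD hE
      compl_mem' := fun hD => Set.Definable.compl (L := colLang ι) hD
      bot_mem' := Set.definable_empty (L := colLang ι) }
  exact (BooleanSubalgebra.closure_le (L := K)).2 h hD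

theorem def_atom {A : Set S} {κ : Type} {ℬ : Set (Set (κ → S))} (hℬ : ℬ.Finite)
    (h : ∀ B ∈ ℬ, Def U A B) (a : κ → S) : Def U A (atom ℬ a) :=
  def_of_mem_closure h (atom_mem_closure hℬ a)

theorem def₁_atom {A : Set S} {ℬ : Set (Set S)} (hℬ : ℬ.Finite) (h : ∀ B ∈ ℬ, Def₁ U A B) (x : S) :
    Def₁ U A (atom ℬ x) := by
  have h' := def_atom (U := U) (A := A) (hℬ.image fun B => {p : Fin 1 → S | p 0 ∈ B})
    (by rintro _ ⟨B, hB, rfl⟩; exact h B hB) fun _ => x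
  refine (congrArg (Def U A) ?_).mp h'
  ext p
  simp [atom]

/-! ### Compositions of cut functions -/

theorem IsComp.mono {𝒱 𝒱' : Set (Set S)} (h𝒱 : 𝒱 ⊆ 𝒱') {k : ℕ}
    {F : Completion U → Completion U} (hF : IsComp U 𝒱 k F) : IsComp U 𝒱' k F := by
  induction hF with
  | id => exact .id
  | minus V hV hdef _ ih => exact .minus V (h𝒱 hV) hdef ih
  | plus V hV hdef _ ih => exact .plus V (h𝒱 hV) hdef ih

/-- The compositions of fewer than `n` cut functions. -/
def compBelow (U : ι → Set S) (𝒱 : Set (Set S)) (n : ℕ) : Set (Completion U → Completion U) :=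
  {F | ∃ k < n, IsComp U 𝒱 k F}

theorem finite_isComp {𝒱 : Set (Set S)} (h𝒱 : 𝒱.Finite) (k : ℕ) :
    {F | IsComp U 𝒱 k F}.Finite := by
  classical
  induction k with
  | zero =>
    refine (Set.finite_singleton _root_.id).subset fun F hF => ?_
    cases hF
    rfl
  | succ k ih =>
    -- Cut functions require a definability proof; the default value `F` makes the operation total
    -- in `V`, so that finiteness of images applies.
    let m (V : Set S) (F : Completion U → Completion U) : Completion U → Completion U :=
      if h : Def₁ U ∅ V then cutMinus U V h ∘ F else F
    let p (V : Set S) (F : Completion U → Completion U) : Completion U → Completion U :=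
      if h : Def₁ U ∅ V then cutPlus U V h ∘ F else F
    refine ((h𝒱.image2 m ih).union (h𝒱.image2 p ih)).subset fun F hF => ?_
    cases hF with
    | minus V hV hdef hF => exact Or.inl ⟨V, hV, _, hF, dif_pos hdef⟩
    | plus V hV hdef hF => exact Or.inr ⟨V, hV, _, hF, dif_pos hdef⟩

theorem finite_compBelow {𝒱 : Set (Set S)} (h𝒱 : 𝒱.Finite) (n : ℕ) :
    (compBelow U 𝒱 n).Finite := by
  refine ((Set.finite_lt_nat n).biUnion fun k _ => finite_isComp (U := U) h𝒱 k).subset ?_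
  rintro F ⟨k, hk, hF⟩
  exact Set.mem_biUnion hk hF

/-! ### Existence of color refinements -/

/-- The sets that stage `n` of a color refinement has to refine, `𝒱` being the earlier colors. -/
def stageSets (U : ι → Set S) (n : ℕ) (𝒱 : Set (Set S)) : Set (Set S) :=
  (Set.range U ∪ 𝒱) ∪
  (Set.image2 (fun F G => {x | F (toCut U x) < G (toCut U x)}) (compBelow U 𝒱 n)
    (compBelow U 𝒱 n) ∪
  Set.image2 (fun F V => {x | F (toCut U x) ∈ toCut U '' V}) (compBelow U 𝒱 n) 𝒱)

theorem finite_stageSets [Finite ι] (n : ℕ) {𝒱 : Set (Set S)} (h𝒱 : 𝒱.Finite) :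
    (stageSets U n 𝒱).Finite :=
  ((Set.finite_range U).union h𝒱).union
    (((finite_compBelow h𝒱 n).image2 _ (finite_compBelow h𝒱 n)).union
      ((finite_compBelow h𝒱 n).image2 _ h𝒱))

theorem def₁_stageSets (n : ℕ) {𝒱 : Set (Set S)} (h : ∀ V ∈ 𝒱, Def₁ U ∅ V) :
    ∀ B ∈ stageSets U n 𝒱, Def₁ U ∅ B := by
  rintro B ((⟨i, rfl⟩ | hB) | ⟨F, ⟨k, -, hF⟩, G, ⟨l, -, hG⟩, rfl⟩ | ⟨F, ⟨k, -, hF⟩, V, hV, rfl⟩)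
  · exact def₁_color i
  · exact h B hB
  · exact ((DefFamily.coord (0 : Fin 1)).comp hF).lt ((DefFamily.coord (0 : Fin 1)).comp hG)
  · exact ((DefFamily.coord (0 : Fin 1)).comp hF).mem_image (h V hV)

/-- The colors of index less than `n` in the coarsest color refinement. -/
def stageColors (U : ι → Set S) : ℕ → Set (Set S)
  | 0 => ∅
  | n + 1 => stageColors U n ∪ atom (stageSets U n (stageColors U n)) '' Set.univ

theorem colorsBelow_succ {X : Type*} (𝒰 : ℕ → Set (Set X)) (n : ℕ) :
    colorsBelow 𝒰 (n + 1) = colorsBelow 𝒰 n ∪ 𝒰 n := by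
  ext V
  simp only [colorsBelow, Set.mem_iUnion, exists_prop, Set.mem_union, Nat.lt_succ_iff_lt_or_eq,
    or_and_right, exists_or, exists_eq_left]

theorem colorsBelow_stage (n : ℕ) :
    colorsBelow (fun n => atom (stageSets U n (stageColors U n)) '' Set.univ) n =
      stageColors U n := by
  induction n with
  | zero => simp [colorsBelow, stageColors]
  | succ n ih => rw [colorsBelow_succ, ih, stageColors]

theorem stageColors_spec [Finite ι] (n : ℕ) :
    (stageColors U n).Finite ∧ ∀ V ∈ stageColors U n, Def₁ U ∅ V := by
  induction n with
  | zero => simp [stageColors]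
  | succ n ih =>
    have hfin := finite_stageSets (U := U) n ih.1
    refine ⟨ih.1.union ((finite_range_atom hfin).subset (Set.image_subset_range _ _)), ?_⟩
    rintro V (hV | ⟨x, -, rfl⟩)
    · exact ih.2 V hV
    · exact def₁_atom hfin (def₁_stageSets n ih.2) x

theorem exists_isColorRefinement [Finite ι] (U : ι → Set S) :
    ∃ 𝒰 : ℕ → Set (Set S), IsColorRefinement U 𝒰 := by
  refine ⟨fun n => atom (stageSets U n (stageColors U n)) '' Set.univ, ?_, ?_, ?_, ?_, ?_, ?_⟩
  · exact fun n => isFinPartition_atoms (finite_stageSets n (stageColors_spec n).1)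
      fun _ _ => Set.subset_univ _
  · rintro n _ ⟨x, -, rfl⟩
    exact def₁_atom (finite_stageSets n (stageColors_spec n).1)
      (def₁_stageSets n (stageColors_spec n).2) x
  · exact fun i => refines_atoms (Or.inl (Or.inl ⟨i, rfl⟩)) _
  · exact fun n V hV => refines_atoms (Or.inl (Or.inr (Or.inr hV))) _
  · intro n k l F G hk hl hF hG
    rw [colorsBelow_stage] at hF hG
    exact refines_atoms (Or.inr (Or.inl ⟨F, ⟨k, hk, hF⟩, G, ⟨l, hl, hG⟩, rfl⟩)) _
  · intro n k F hk hF V hV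
    rw [colorsBelow_stage] at hF hV
    exact refines_atoms (Or.inr (Or.inr ⟨F, ⟨k, hk, hF⟩, V, hV, rfl⟩)) _

/-! ### Deciding sets by a color -/

section

variable {X : Type*} {𝒰 : ℕ → Set (Set X)}

theorem colorsBelow_mono {m n : ℕ} (h : m ≤ n) : colorsBelow 𝒰 m ⊆ colorsBelow 𝒰 n :=
  Set.biUnion_subset_biUnion_left fun _ hk => lt_of_lt_of_le hk h

theorem colorsBelow_subset (n : ℕ) : colorsBelow 𝒰 n ⊆ allColors 𝒰 :=
  Set.iUnion₂_subset fun k _ => Set.subset_iUnion 𝒰 k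

theorem mem_colorsBelow {n k : ℕ} (h : k < n) {V : Set X} (hV : V ∈ 𝒰 k) :
    V ∈ colorsBelow 𝒰 n :=
  Set.mem_biUnion h hV

theorem exists_mem_colorsBelow {V : Set X} (hV : V ∈ allColors 𝒰) : ∃ n, V ∈ colorsBelow 𝒰 n := by
  obtain ⟨n, hn⟩ := Set.mem_iUnion.1 hV
  exact ⟨n + 1, mem_colorsBelow n.lt_succ_self hn⟩

end

variable {𝒰 : ℕ → Set (Set S)}

theorem compBelow_mono {m n : ℕ} (h : m ≤ n) :
    compBelow U (colorsBelow 𝒰 m) m ⊆ compBelow U (colorsBelow 𝒰 n) n :=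
  fun _ ⟨k, hk, hF⟩ => ⟨k, hk.trans_le h, hF.mono (colorsBelow_mono h)⟩

theorem cutFunctions_of_compBelow {n : ℕ} {F : Completion U → Completion U}
    (hF : F ∈ compBelow U (colorsBelow 𝒰 n) n) : F ∈ cutFunctions U (allColors 𝒰) :=
  let ⟨k, _, hF⟩ := hF
  ⟨k, hF.mono (colorsBelow_subset n)⟩

namespace IsColorRefinement

theorem exists_mem (h : IsColorRefinement U 𝒰) (n : ℕ) (x : S) : ∃ P ∈ 𝒰 n, x ∈ P :=
  Set.mem_sUnion.1 ((h.partition n).sUnion_eq ▸ Set.mem_univ x)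

theorem mem_iff_of_refines (h : IsColorRefinement U 𝒰) {n : ℕ} {B : Set S} (hB : Refines (𝒰 n) B) {x y : S}
    (hxy : ∀ P ∈ 𝒰 n, x ∈ P ↔ y ∈ P) : x ∈ B ↔ y ∈ B := by
  obtain ⟨P, hP, hx⟩ := h.exists_mem n x
  rcases hB P hP with hPB | hPB
  · exact iff_of_true (hPB hx) (hPB ((hxy P hP).1 hx))
  · exact iff_of_false (hPB hx) (hPB ((hxy P hP).1 hx))

theorem mem_iff_of_le (h : IsColorRefinement U 𝒰) {m n : ℕ} (hmn : m ≤ n) {x y : S} (hxy : ∀ P ∈ 𝒰 n, x ∈ P ↔ y ∈ P) :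
    ∀ P ∈ 𝒰 m, x ∈ P ↔ y ∈ P := by
  induction n, hmn using Nat.le_induction with
  | base => exact hxy
  | succ n _ ih => exact ih fun P hP => h.mem_iff_of_refines (h.refines_succ n P hP) hxy

theorem finite_colorsBelow (h : IsColorRefinement U 𝒰) (n : ℕ) : (colorsBelow 𝒰 n).Finite :=
  (Set.finite_lt_nat n).biUnion fun k _ => (h.partition k).finite

theorem definable_colorsBelow (h : IsColorRefinement U 𝒰) {n : ℕ} : ∀ V ∈ colorsBelow 𝒰 n, Def₁ U ∅ V := by
  intro V hV
  obtain ⟨k, -, hk⟩ := Set.mem_iUnion₂.1 hV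
  exact h.definable k V hk

end IsColorRefinement

/-! ### Similar tuples -/

instance {κ : Type} [Finite κ] : Finite (Proj κ) :=
  Finite.of_surjective (fun o : Option (Option κ) => o.elim Proj.min fun o => o.elim .max .coord) <| by
    rintro (i | _ | _)
    exacts [⟨some (some i), rfl⟩, ⟨none, rfl⟩, ⟨some none, rfl⟩]

section sim

variable {κ κ' : Type}

/-- Two tuples are similar at stage `n` if corresponding coordinates have the same color at this
stage and compositions of fewer than `n` cut functions with earlier colors take values in the same
order. -/
structure Sim (U : ι → Set S) (𝒰 : ℕ → Set (Set S)) (n : ℕ) (a a' : κ → S) : Prop where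
  color : ∀ i, ∀ P ∈ 𝒰 n, a i ∈ P ↔ a' i ∈ P
  lt : ∀ F ∈ compBelow U (colorsBelow 𝒰 n) n, ∀ G ∈ compBelow U (colorsBelow 𝒰 n) n,
    ∀ π π' : Proj κ, F (π.eval U a) < G (π'.eval U a) ↔ F (π.eval U a') < G (π'.eval U a')

theorem Sim.symm {n : ℕ} {a a' : κ → S} (h : Sim U 𝒰 n a a') : Sim U 𝒰 n a' a :=
  ⟨fun i P hP => (h.color i P hP).symm, fun F hF G hG π π' => (h.lt F hF G hG π π').symm⟩

theorem Sim.mono {m n : ℕ} {a a' : κ → S} (h : IsColorRefinement U 𝒰) (hmn : m ≤ n)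
    (ha : Sim U 𝒰 n a a') : Sim U 𝒰 m a a' :=
  ⟨fun i => h.mem_iff_of_le hmn (ha.color i),
    fun F hF G hG => ha.lt F (compBelow_mono hmn hF) G (compBelow_mono hmn hG)⟩

/-- Composition of a coordinate projection with a map of index sets. -/
def Proj.map (f : κ → κ') : Proj κ → Proj κ'
  | .coord i => .coord (f i)
  | .min => .min
  | .max => .max

theorem Proj.eval_map (f : κ → κ') (π : Proj κ) (a : κ' → S) :
    (π.map f).eval U a = π.eval U (a ∘ f) := by
  cases π <;> rfl

theorem Sim.comp {n : ℕ} {a a' : κ' → S} (h : Sim U 𝒰 n a a') (f : κ → κ') :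
    Sim U 𝒰 n (a ∘ f) (a' ∘ f) :=
  ⟨fun i => h.color (f i), fun F hF G hG π π' => by
    simpa only [Proj.eval_map] using h.lt F hF G hG (π.map f) (π'.map f)⟩

/-- Membership in a color is not part of similarity. For a coordinate it is decided by the color of
that coordinate, through `refines_mem`; for the constants it does not involve the tuple. -/
theorem Sim.mem_iff {n k : ℕ} {a a' : κ → S} (h : IsColorRefinement U 𝒰) (ha : Sim U 𝒰 n a a')
    (hk : k < n) {F : Completion U → Completion U} (hF : IsComp U (colorsBelow 𝒰 n) k F)
    {V : Set S} (hV : V ∈ colorsBelow 𝒰 n) (π : Proj κ) :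
    F (π.eval U a) ∈ toCut U '' V ↔ F (π.eval U a') ∈ toCut U '' V := by
  cases π with
  | coord i => exact h.mem_iff_of_refines (h.refines_mem n k F hk hF V hV) (ha.color i)
  | min => exact Iff.rfl
  | max => exact Iff.rfl

/-- The sets of tuples that are decided by similarity at stage `n`. -/
def simSets (U : ι → Set S) (𝒰 : ℕ → Set (Set S)) (κ : Type) (n : ℕ) : Set (Set (κ → S)) :=
  Set.image2 (fun i P => {a | a i ∈ P}) Set.univ (𝒰 n) ∪
  Set.image2 (fun (p : (Completion U → Completion U) × (Completion U → Completion U))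
      (q : Proj κ × Proj κ) => {a | p.1 (q.1.eval U a) < p.2 (q.2.eval U a)})
    (compBelow U (colorsBelow 𝒰 n) n ×ˢ compBelow U (colorsBelow 𝒰 n) n) Set.univ

theorem mem_atom_simSets {n : ℕ} {a a' : κ → S} :
    a' ∈ atom (simSets U 𝒰 κ n) a ↔ Sim U 𝒰 n a a' := by
  constructor
  · exact fun ha => ⟨fun i P hP => ha _ (Or.inl ⟨i, trivial, P, hP, rfl⟩),
      fun F hF G hG π π' => ha _ (Or.inr ⟨(F, G), ⟨hF, hG⟩, (π, π'), trivial, rfl⟩)⟩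
  · rintro ha _ (⟨i, -, P, hP, rfl⟩ | ⟨⟨F, G⟩, ⟨hF, hG⟩, ⟨π, π'⟩, -, rfl⟩)
    · exact ha.color i P hP
    · exact ha.lt F hF G hG π π'

theorem simSets_subset (n : ℕ) : simSets U 𝒰 κ n ⊆ basicSets U (allColors 𝒰) κ := by
  rintro _ (⟨i, -, P, hP, rfl⟩ | ⟨⟨F, G⟩, ⟨hF, hG⟩, ⟨π, π'⟩, -, rfl⟩)
  · refine Or.inl ⟨.coord i, P, Set.mem_iUnion.2 ⟨n, hP⟩, ?_⟩
    ext a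
    exact (mem_image_toCut (U := U)).symm
  · exact Or.inr ⟨F, cutFunctions_of_compBelow hF, G, cutFunctions_of_compBelow hG, π, π', rfl⟩

theorem finite_simSets [Finite κ] (h : IsColorRefinement U 𝒰) (n : ℕ) :
    (simSets U 𝒰 κ n).Finite :=
  have hc := finite_compBelow (U := U) (h.finite_colorsBelow n) n
  (Set.finite_univ.image2 _ (h.partition n).finite).union ((hc.prod hc).image2 _ Set.finite_univ)

theorem def_simSets [Finite κ] (h : IsColorRefinement U 𝒰) (n : ℕ) :
    ∀ B ∈ simSets U 𝒰 κ n, Def U ∅ B := by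
  rintro _ (⟨i, -, P, hP, rfl⟩ | ⟨⟨F, G⟩, ⟨⟨k, -, hF⟩, l, -, hG⟩, ⟨π, π'⟩, -, rfl⟩)
  · exact (h.definable n P hP).coord i
  · exact ((DefFamily.proj π).comp hF).lt ((DefFamily.proj π').comp hG)

/-- `D` is a union of classes of similar tuples, at some stage. -/
def SimInvariant (U : ι → Set S) (𝒰 : ℕ → Set (Set S)) (D : Set (κ → S)) : Prop :=
  ∃ n, ∀ a a', Sim U 𝒰 n a a' → (a ∈ D ↔ a' ∈ D)

theorem SimInvariant.mem_closure [Finite κ] (h : IsColorRefinement U 𝒰) {D : Set (κ → S)}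
    (hD : SimInvariant U 𝒰 D) :
    D ∈ BooleanSubalgebra.closure (basicSets U (allColors 𝒰) κ) := by
  obtain ⟨n, hn⟩ := hD
  exact BooleanSubalgebra.closure_mono (simSets_subset n) <|
    mem_closure_of_determined (finite_simSets h n) fun a a' haa' =>
      (hn a a' (mem_atom_simSets.1 haa')).1

/-! ### Extending similar tuples by a point -/

/-- The points `x` and `y` have the same color at stage `n` and the same position with respect to
the values of short compositions at `a` and at `c` respectively. -/
structure SameCell (U : ι → Set S) (𝒰 : ℕ → Set (Set S)) (n : ℕ) (x : S) (a : κ → S) (y : S)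
    (c : κ → S) : Prop where
  color : ∀ P ∈ 𝒰 n, x ∈ P ↔ y ∈ P
  lt : ∀ k ≤ 2 * n, ∀ F, IsComp U (colorsBelow 𝒰 n) k F → ∀ π : Proj κ,
    (F (π.eval U a) < toCut U x ↔ F (π.eval U c) < toCut U y)
  gt : ∀ k ≤ 2 * n, ∀ F, IsComp U (colorsBelow 𝒰 n) k F → ∀ π : Proj κ,
    (toCut U x < F (π.eval U a) ↔ toCut U y < F (π.eval U c))

variable {n : ℕ} {x y z : S} {a c d : κ → S}

theorem SameCell.symm (h : SameCell U 𝒰 n x a y c) : SameCell U 𝒰 n y c x a :=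
  ⟨fun P hP => (h.color P hP).symm, fun k hk F hF π => (h.lt k hk F hF π).symm,
    fun k hk F hF π => (h.gt k hk F hF π).symm⟩

theorem SameCell.trans (h : SameCell U 𝒰 n x a y c) (h' : SameCell U 𝒰 n y c z d) :
    SameCell U 𝒰 n x a z d :=
  ⟨fun P hP => (h.color P hP).trans (h'.color P hP),
    fun k hk F hF π => (h.lt k hk F hF π).trans (h'.lt k hk F hF π),
    fun k hk F hF π => (h.gt k hk F hF π).trans (h'.gt k hk F hF π)⟩

theorem Sim.lt_iff {m k l : ℕ} (hac : Sim U 𝒰 m a c) (hmn : n ≤ m) (hk : k < m) (hl : l < m)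
    {F G : Completion U → Completion U} (hF : IsComp U (colorsBelow 𝒰 n) k F)
    (hG : IsComp U (colorsBelow 𝒰 n) l G) (π π' : Proj κ) :
    F (π.eval U a) < G (π'.eval U a) ↔ F (π.eval U c) < G (π'.eval U c) :=
  hac.lt F ⟨k, hk, hF.mono (colorsBelow_mono hmn)⟩ G ⟨l, hl, hG.mono (colorsBelow_mono hmn)⟩ π π'

/-- Induction on `F`: its outermost function is transferred to `G`, which preserves the bound on `k
+ l`, until `x` itself is compared with a value at `a`. -/
theorem SameCell.comp_lt_iff (h : IsColorRefinement U 𝒰) (hac : Sim U 𝒰 (2 * n + 2) a c)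
    (hxy : SameCell U 𝒰 n x a y c) {k : ℕ} {F : Completion U → Completion U}
    (hF : IsComp U (colorsBelow 𝒰 n) k F) : ∀ l, k + l ≤ 2 * n → ∀ G,
    IsComp U (colorsBelow 𝒰 n) l G → ∀ π : Proj κ,
    (G (π.eval U a) < F (toCut U x) ↔ G (π.eval U c) < F (toCut U y)) ∧
    (F (toCut U x) < G (π.eval U a) ↔ F (toCut U y) < G (π.eval U c)) := by
  induction hF with
  | id => exact fun l hl G hG π =>
      ⟨hxy.lt l (by omega) G hG π, hxy.gt l (by omega) G hG π⟩
  | @minus k F V hV hdef hF ih =>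
    intro l hl G hG π
    have hm := ih (l + 1) (by omega) _ (hG.minus V hV hdef) π
    have hp := ih (l + 1) (by omega) _ (hG.plus V hV hdef) π
    have h0 := ih l (by omega) G hG π
    have hmem := hac.mem_iff h (by omega) (hG.mono (colorsBelow_mono (by omega)))
      (colorsBelow_mono (by omega) hV) π
    -- This decides whether the value of `G` is a limit of `V` from below, the last case of
    -- `le_cutMinus_iff`.
    have hlim := hac.lt_iff (n := n) (by omega) (by omega) (by omega) (hG.minus V hV hdef) hG π π
    simp only [Function.comp_apply] at hm hp hlim ⊢
    constructor
    · rw [← cutPlus_lt_iff_lt_cutMinus, ← cutPlus_lt_iff_lt_cutMinus, hp.1]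
    · rw [← not_iff_not, not_lt, not_lt]
      exact (le_cutMinus_iff hdef).trans <| (or_congr hp.1 <| or_congr (and_congr hmem h0.1) <|
        and_congr (le_iff_le_iff_lt_iff_lt.2 hlim) (le_iff_le_iff_lt_iff_lt.2 h0.2)).trans
          (le_cutMinus_iff hdef).symm
  | @plus k F V hV hdef hF ih =>
    intro l hl G hG π
    have hm := ih (l + 1) (by omega) _ (hG.minus V hV hdef) π
    have hp := ih (l + 1) (by omega) _ (hG.plus V hV hdef) π
    have h0 := ih l (by omega) G hG π
    have hmem := hac.mem_iff h (by omega) (hG.mono (colorsBelow_mono (by omega)))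
      (colorsBelow_mono (by omega) hV) π
    have hlim := hac.lt_iff (n := n) (by omega) (by omega) (by omega) hG (hG.plus V hV hdef) π π
    simp only [Function.comp_apply] at hm hp hlim ⊢
    constructor
    · rw [← not_iff_not, not_lt, not_lt]
      exact (cutPlus_le_iff hdef).trans <| (or_congr hm.2 <| or_congr (and_congr hmem h0.2) <|
        and_congr (le_iff_le_iff_lt_iff_lt.2 hlim) (le_iff_le_iff_lt_iff_lt.2 h0.1)).trans
          (cutPlus_le_iff hdef).symm
    · rw [cutPlus_lt_iff_lt_cutMinus, cutPlus_lt_iff_lt_cutMinus, hm.2]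

/-- The tuple obtained by adding an entry. -/
def extend (x : S) (a : κ → S) : Option κ → S := fun o => o.elim x a

/-- A comparison involves the new point on both sides, on one side, or not at all; these are settled
by its color, by `comp_lt_iff`, and by the similarity of `a` and `c`. -/
theorem SameCell.sim_extend (h : IsColorRefinement U 𝒰) (hac : Sim U 𝒰 (2 * n + 2) a c)
    (hxy : SameCell U 𝒰 n x a y c) : Sim U 𝒰 n (extend x a) (extend y c) := by
  have hac' := hac.mono h (show n ≤ 2 * n + 2 by omega)
  have key : ∀ π : Proj (Option κ), π = .coord none ∨ ∃ π₀ : Proj κ, π = π₀.map some := by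
    rintro ((_ | i) | _ | _)
    exacts [Or.inl rfl, Or.inr ⟨.coord i, rfl⟩, Or.inr ⟨.min, rfl⟩, Or.inr ⟨.max, rfl⟩]
  refine ⟨?_, ?_⟩
  · rintro (_ | i)
    · exact hxy.color
    · exact hac'.color i
  · rintro F ⟨k, hk, hF⟩ G ⟨l, hl, hG⟩ π π'
    rcases key π with rfl | ⟨π, rfl⟩ <;> rcases key π' with rfl | ⟨π', rfl⟩
    · exact h.mem_iff_of_refines (h.refines_lt n k l F G hk hl hF hG) hxy.color
    · simp only [Proj.eval_map]
      exact (hxy.comp_lt_iff h hac hF l (by omega) G hG π').2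
    · simp only [Proj.eval_map]
      exact (hxy.comp_lt_iff h hac hG k (by omega) F hF π).1
    · simp only [Proj.eval_map]
      exact hac'.lt F ⟨k, hk, hF⟩ G ⟨l, hl, hG⟩ π π'

end sim

/-! ### Positions are cells, and the extension step -/

section cells

variable {κ : Type} {n : ℕ} {x : S} {a c : κ → S}

theorem IsColorRefinement.mem_iff_of_mem (h : IsColorRefinement U 𝒰) {n : ℕ} {P : Set S}
    (hP : P ∈ 𝒰 n) {x y : S} (hx : x ∈ P) (hy : y ∈ P) : ∀ Q ∈ 𝒰 n, x ∈ Q ↔ y ∈ Q := by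
  intro Q hQ
  by_cases hPQ : P = Q
  · exact hPQ ▸ iff_of_true hx hy
  · have := Set.disjoint_left.1 ((h.partition n).disjoint hP hQ hPQ)
    exact iff_of_false (this hx) (this hy)

theorem exists_cell_of_eq (h : IsColorRefinement U 𝒰) {k : ℕ} (hk : k ≤ 2 * n)
    {F : Completion U → Completion U} (hF : IsComp U (colorsBelow 𝒰 n) k F) {π : Proj κ}
    (hx : F (π.eval U a) = toCut U x) (hac : Sim U 𝒰 (2 * n + 2) a c) :
    {y | F (π.eval U c) = toCut U y} = {y | SameCell U 𝒰 n x a y c} ∧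
      {y | F (π.eval U c) = toCut U y}.Nonempty := by
  obtain ⟨P, hP, hxP⟩ := h.exists_mem n x
  -- Similarity transfers the fact that the value of `F` is a point of color `P`, so the value at
  -- `c` is a point of `S` as well.
  obtain ⟨z, hz, hzc⟩ := (hac.mem_iff h (by omega) (hF.mono (colorsBelow_mono (by omega)))
    (mem_colorsBelow (show n < 2 * n + 2 by omega) hP) π).1 (hx ▸ ⟨x, hxP, rfl⟩)
  refine ⟨?_, z, hzc.symm⟩
  ext y
  constructor
  · intro hy
    have hy : F (π.eval U c) = toCut U y := hy
    obtain rfl : z = y := toCut_injective (hzc.trans hy)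
    refine ⟨h.mem_iff_of_mem hP hxP hz, fun l hl G hG π' => ?_, fun l hl G hG π' => ?_⟩
    · rw [← hx, ← hy, hac.lt_iff (n := n) (by omega) (by omega) (by omega) hG hF]
    · rw [← hx, ← hy, hac.lt_iff (n := n) (by omega) (by omega) (by omega) hF hG]
  · intro hy
    refine le_antisymm ?_ ?_
    · rw [← not_lt, ← hy.gt k hk F hF π, hx]
      exact lt_irrefl _
    · rw [← not_lt, ← hy.lt k hk F hF π, hx]
      exact lt_irrefl _

/-- The points in the same position as `x` form a cell, uniformly for all similar tuples. -/
theorem exists_cell [Finite κ] (h : IsColorRefinement U 𝒰) (n : ℕ) (x : S) (a : κ → S) :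
    ∃ C : (κ → S) → Set S, IsCell U (allColors 𝒰) C ∧ ∀ c, Sim U 𝒰 (2 * n + 2) a c →
      C c = {y | SameCell U 𝒰 n x a y c} ∧ (C c).Nonempty := by
  by_cases hW : ∃ k ≤ 2 * n, ∃ F, IsComp U (colorsBelow 𝒰 n) k F ∧ ∃ π : Proj κ,
      F (π.eval U a) = toCut U x
  · obtain ⟨k, hk, F, hF, π, hx⟩ := hW
    exact ⟨_, .point ⟨k, hF.mono (colorsBelow_subset n)⟩ π,
      fun c hac => exists_cell_of_eq h hk hF hx hac⟩
  push Not at hW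
  obtain ⟨P, hP, hxP⟩ := h.exists_mem n x
  have hfin : (compBelow U (colorsBelow 𝒰 n) (2 * n + 1) ×ˢ (Set.univ : Set (Proj κ))).Finite :=
    (finite_compBelow (h.finite_colorsBelow n) _).prod Set.finite_univ
  -- `L` gives the greatest value below `x` and, next, `R` the least value above it. The identity at
  -- the minimum and at the maximum shows that such values exist: by `hW` neither constant equals
  -- `x`.
  obtain ⟨⟨L, π⟩, ⟨⟨⟨k, hk, hL⟩, -⟩, hLx⟩, hmax⟩ := Set.exists_max_image
    {p ∈ compBelow U (colorsBelow 𝒰 n) (2 * n + 1) ×ˢ (Set.univ : Set (Proj κ)) |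
      p.1 (p.2.eval U a) < toCut U x} (fun p => p.1 (p.2.eval U a))
    (hfin.subset (Set.sep_subset _ _)) ⟨(id, .min), ⟨⟨0, by omega, .id⟩, trivial⟩,
      lt_of_le_of_ne bot_le (hW 0 (by omega) _ .id .min)⟩
  obtain ⟨⟨R, π'⟩, ⟨⟨⟨l, hl, hR⟩, -⟩, hRx⟩, hmin⟩ := Set.exists_min_image
    {p ∈ compBelow U (colorsBelow 𝒰 n) (2 * n + 1) ×ˢ (Set.univ : Set (Proj κ)) |
      toCut U x < p.1 (p.2.eval U a)} (fun p => p.1 (p.2.eval U a))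
    (hfin.subset (Set.sep_subset _ _)) ⟨(id, .max), ⟨⟨0, by omega, .id⟩, trivial⟩,
      lt_of_le_of_ne le_top (hW 0 (by omega) _ .id .max).symm⟩
  have hLx : L (π.eval U a) < toCut U x := hLx
  have hRx : toCut U x < R (π'.eval U a) := hRx
  refine ⟨_, .interval ⟨k, hL.mono (colorsBelow_subset n)⟩ ⟨l, hR.mono (colorsBelow_subset n)⟩ π π'
    (Set.mem_iUnion.2 ⟨n, hP⟩), fun c hac => ⟨?_, ?_⟩⟩
  · ext y
    constructor
    · rintro ⟨hLy, hyR, hyP⟩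
      have below : ∀ m ≤ 2 * n, ∀ G, IsComp U (colorsBelow 𝒰 n) m G → ∀ ρ : Proj κ,
          G (ρ.eval U a) < toCut U x → G (ρ.eval U c) < toCut U y := fun m hm G hG ρ hlt =>
        lt_of_le_of_lt ((le_iff_le_iff_lt_iff_lt.2 (hac.lt_iff (n := n) (by omega) (by omega)
          (by omega) hL hG π ρ)).1
            (hmax (G, ρ) ⟨⟨⟨m, by omega, hG⟩, trivial⟩, hlt⟩)) hLy
      have above : ∀ m ≤ 2 * n, ∀ G, IsComp U (colorsBelow 𝒰 n) m G → ∀ ρ : Proj κ,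
          toCut U x < G (ρ.eval U a) → toCut U y < G (ρ.eval U c) := fun m hm G hG ρ hlt =>
        lt_of_lt_of_le hyR ((le_iff_le_iff_lt_iff_lt.2 (hac.lt_iff (n := n) (by omega) (by omega)
          (by omega) hG hR ρ π')).1
            (hmin (G, ρ) ⟨⟨⟨m, by omega, hG⟩, trivial⟩, hlt⟩))
      refine ⟨h.mem_iff_of_mem hP hxP hyP, fun m hm G hG ρ => ⟨below m hm G hG ρ, fun hlt => ?_⟩,
        fun m hm G hG ρ => ⟨above m hm G hG ρ, fun hlt => ?_⟩⟩
      -- By `hW` no value at `a` equals `x`, so each lies strictly on one side, and `below` and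
      -- `above` yield the converses too.
      · by_contra! hx
        exact (above m hm G hG ρ (lt_of_le_of_ne hx (hW m hm G hG ρ).symm)).not_gt hlt
      · by_contra! hx
        exact (below m hm G hG ρ (lt_of_le_of_ne hx (hW m hm G hG ρ))).not_gt hlt
    · intro hy
      exact ⟨(hy.lt k (by omega) L hL π).1 hLx, (hy.gt l (by omega) R hR π').1 hRx,
        (hy.color P hP).1 hxP⟩
  · have hdef := h.definable n P hP
    -- The cell is nonempty exactly when `P₊(L) < R`. This composition has length up to `2 * n + 1`,
    -- whence the stage `2 * n + 2`; the bound `n + 1` admits `P` as an earlier color.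
    have hp := hac.lt_iff (n := n + 1) (by omega) (by omega) (by omega)
      ((hL.mono (colorsBelow_mono n.le_succ)).plus P (mem_colorsBelow n.lt_succ_self hP) hdef)
      (hR.mono (colorsBelow_mono n.le_succ)) π π'
    obtain ⟨y, hyP, hLy, hyR⟩ := (cutPlus_lt_iff hdef).1
      (hp.1 ((cutPlus_lt_iff hdef).2 ⟨x, hxP, hLx, hRx⟩))
    exact ⟨y, hLy, hyR, hyP⟩

theorem exists_sameCell [Finite κ] (h : IsColorRefinement U 𝒰)
    (hac : Sim U 𝒰 (2 * n + 2) a c) (x : S) : ∃ y, SameCell U 𝒰 n x a y c := by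
  obtain ⟨C, -, hC⟩ := exists_cell h n x a
  obtain ⟨h1, y, hy⟩ := hC c hac
  exact ⟨y, h1.subset hy⟩

end cells

/-! ### Definable sets are unions of similarity classes -/

theorem exists_term_eq_var {κ : Type*} (t : (colLang ι).Term κ) :
    ∃ i, t = FirstOrder.Language.Term.var i := by
  cases t with
  | var i => exact ⟨i, rfl⟩
  | func f _ => exact f.elim

theorem Sim.coord_lt_iff {κ : Type} {a a' : κ → S} (h : Sim U 𝒰 1 a a') (i j : κ) :
    a i < a j ↔ a' i < a' j := by
  have := h.lt id ⟨0, one_pos, .id⟩ id ⟨0, one_pos, .id⟩ (.coord i) (.coord j)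
  simpa only [id, Proj.eval, toCut_lt_toCut] using this

/-- Each quantifier raises the stage from `n` to `2 * n + 2`, by the extension step. -/
theorem simInvariant_boundedFormula {κ : Type} [Finite κ] (h : IsColorRefinement U 𝒰) {n : ℕ}
    (φ : (colLang ι).BoundedFormula κ n) :
    letI := colStructure U
    SimInvariant U 𝒰 {v : κ ⊕ Fin n → S | φ.Realize (v ∘ Sum.inl) (v ∘ Sum.inr)} := by
  let _ := colStructure U
  induction φ with
  | falsum => exact ⟨0, fun _ _ _ => Iff.rfl⟩
  | equal t₁ t₂ =>
    obtain ⟨i, rfl⟩ := exists_term_eq_var t₁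
    obtain ⟨j, rfl⟩ := exists_term_eq_var t₂
    -- Stage 1 is the first at which the identity is among the compositions compared.
    refine ⟨1, fun a a' haa' => ?_⟩
    have h1 := haa'.coord_lt_iff i j
    have h2 := haa'.coord_lt_iff j i
    have : a i = a j ↔ a' i = a' j := by
      rw [eq_iff_le_not_lt, eq_iff_le_not_lt, ← not_lt, ← not_lt, h1, h2]
    simpa [FirstOrder.Language.BoundedFormula.Realize] using this
  | rel R ts =>
    cases R with
    | color i =>
      obtain ⟨j, hj⟩ := exists_term_eq_var (ts 0)
      refine ⟨0, fun a a' haa' => ?_⟩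
      have := h.mem_iff_of_refines (h.refines_colors i) (haa'.color j)
      simpa [FirstOrder.Language.BoundedFormula.Realize, FirstOrder.Language.Structure.RelMap, hj]
        using this
    | lt =>
      obtain ⟨i, hi⟩ := exists_term_eq_var (ts 0)
      obtain ⟨j, hj⟩ := exists_term_eq_var (ts 1)
      refine ⟨1, fun a a' haa' => ?_⟩
      have := haa'.coord_lt_iff i j
      simpa [FirstOrder.Language.BoundedFormula.Realize, FirstOrder.Language.Structure.RelMap, hi,
        hj] using this
  | imp φ ψ ih₁ ih₂ =>
    obtain ⟨n₁, h₁⟩ := ih₁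
    obtain ⟨n₂, h₂⟩ := ih₂
    refine ⟨max n₁ n₂, fun a a' haa' => ?_⟩
    exact imp_congr (h₁ a a' (haa'.mono h (le_max_left _ _)))
      (h₂ a a' (haa'.mono h (le_max_right _ _)))
  | @all m φ ih =>
    obtain ⟨n, hn⟩ := ih
    -- The last bound variable is matched with the entry that `extend` adds.
    let f : κ ⊕ Fin (m + 1) → Option (κ ⊕ Fin m) :=
      Sum.elim (some ∘ Sum.inl) (Fin.snoc (α := fun _ => Option (κ ⊕ Fin m)) (some ∘ Sum.inr) none)
    have hf : ∀ (x : S) (a : κ ⊕ Fin m → S),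
        (extend x a ∘ f) ∘ Sum.inr = Fin.snoc (α := fun _ => S) (a ∘ Sum.inr) x := by
      intro x a
      ext i
      refine Fin.lastCases ?_ (fun i => ?_) i <;> simp [f, extend]
    have key : ∀ a a', Sim U 𝒰 (2 * n + 2) a a' →
        (∀ x, φ.Realize (a ∘ Sum.inl) (Fin.snoc (α := fun _ => S) (a ∘ Sum.inr) x)) →
        ∀ x, φ.Realize (a' ∘ Sum.inl) (Fin.snoc (α := fun _ => S) (a' ∘ Sum.inr) x) := by
      intro a a' haa' ha x'
      obtain ⟨x, hx⟩ := exists_sameCell h haa'.symm x'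
      have := (hn _ _ ((hx.symm.sim_extend h haa').comp f)).1
      simp only [Set.mem_ofPred_eq, hf] at this
      exact this (ha x)
    exact ⟨2 * n + 2, fun a a' haa' => ⟨key a a' haa', key a' a haa'.symm⟩⟩

theorem simInvariant_formula {κ : Type} [Finite κ] (h : IsColorRefinement U 𝒰)
    (φ : (colLang ι).Formula κ) :
    letI := colStructure U
    SimInvariant U 𝒰 {v : κ → S | φ.Realize v} := by
  let _ := colStructure U
  obtain ⟨n, hn⟩ := simInvariant_boundedFormula h φ
  refine ⟨n, fun a a' haa' => ?_⟩
  have e : ∀ v : κ → S, FirstOrder.Language.BoundedFormula.Realize φ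
      ((v ∘ Sum.elim id Fin.elim0) ∘ Sum.inl) ((v ∘ Sum.elim id Fin.elim0) ∘ Sum.inr) ↔
      φ.Realize v := fun v => by
    rw [Subsingleton.elim ((v ∘ Sum.elim id Fin.elim0) ∘ Sum.inr) default]
    rfl
  exact (e a).symm.trans ((hn _ _ (haa'.comp (Sum.elim id Fin.elim0))).trans (e a'))

/-- Parameters are turned into further free variables, so that results without parameters apply to
`Sum.elim v b`. An index is chosen for each parameter, since `b` may have repetitions. -/
theorem exists_formula_of_def {κ : Type} {m : ℕ} {b : Fin m → S} {D : Set (κ → S)}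
    (hD : Def U (Set.range b) D) :
    letI := colStructure U
    ∃ φ : (colLang ι).Formula (κ ⊕ Fin m), ∀ v, v ∈ D ↔ φ.Realize (Sum.elim v b) := by
  let _ := colStructure U
  obtain ⟨φ, rfl⟩ := Set.definable_iff_exists_formula_sum.1 hD
  choose g hg using fun x : Set.range b => x.2
  refine ⟨φ.relabel (Sum.elim (Sum.inr ∘ g) Sum.inl), fun v => ?_⟩
  rw [FirstOrder.Language.Formula.realize_relabel, Set.mem_ofPred_eq]
  congr! 1
  ext (x | i)
  · exact (hg x).symm
  · rfl

theorem def_of_def_empty {κ : Type} {m : ℕ} (b : Fin m → S) {D : Set (κ ⊕ Fin m → S)}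
    (hD : Def U ∅ D) : Def U (Set.range b) {a : κ → S | Sum.elim a b ∈ D} := by
  let _ := colStructure U
  obtain ⟨φ, rfl⟩ := Set.empty_definable_iff.1 hD
  refine Set.definable_iff_exists_formula_sum.2
    ⟨φ.relabel (Sum.elim Sum.inr fun i => Sum.inl ⟨b i, Set.mem_range_self i⟩), ?_⟩
  ext v
  refine Iff.trans ?_ FirstOrder.Language.Formula.realize_relabel.symm
  change φ.Realize _ ↔ _
  congr! 1
  ext (x | i) <;> rfl

theorem exists_sim_of_def {κ : Type} [Finite κ] (h : IsColorRefinement U 𝒰) {m : ℕ} {b : Fin m → S}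
    {D : Set (κ → S)} (hD : Def U (Set.range b) D) :
    ∃ n, ∀ a a', Sim U 𝒰 n (Sum.elim a b) (Sum.elim a' b) → (a ∈ D ↔ a' ∈ D) := by
  obtain ⟨φ, hφ⟩ := exists_formula_of_def hD
  obtain ⟨n, hn⟩ := simInvariant_formula h φ
  exact ⟨n, fun a a' haa' => by rw [hφ, hφ]; exact hn _ _ haa'⟩

/-! ### Partitions into similarity classes over a tuple of parameters -/

/-- The pieces are the atoms of the finite family `simSets`, specialized at `b`. -/
theorem exists_sim_partition {κ : Type} [Finite κ] (h : IsColorRefinement U 𝒰) {m : ℕ}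
    (b : Fin m → S) {T : Set (κ → S)} {n : ℕ}
    (hT : ∀ a a', Sim U 𝒰 n (Sum.elim a b) (Sum.elim a' b) → (a ∈ T ↔ a' ∈ T)) :
    ∃ 𝒬 : Set (Set (κ → S)), IsFinPartition 𝒬 T ∧ ∀ P ∈ 𝒬, Def U (Set.range b) P ∧
      ∃ a ∈ T, ∀ c ∈ P, c ∈ T ∧ Sim U 𝒰 n (Sum.elim a b) (Sum.elim c b) := by
  let ℬ : Set (Set (κ → S)) :=
    (fun B => {a | Sum.elim a b ∈ B}) '' simSets U 𝒰 (κ ⊕ Fin m) n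
  have hfin : ℬ.Finite := (finite_simSets h n).image _
  have hmem : ∀ a, ∀ c ∈ atom ℬ a, Sim U 𝒰 n (Sum.elim a b) (Sum.elim c b) := fun a c hc =>
    mem_atom_simSets.1 fun B hB => hc _ ⟨B, hB, rfl⟩
  have hsub : ∀ a ∈ T, atom ℬ a ⊆ T := fun a ha c hc => (hT a c (hmem a c hc)).1 ha
  refine ⟨_, isFinPartition_atoms hfin hsub, ?_⟩
  rintro _ ⟨a, ha, rfl⟩
  refine ⟨def_atom hfin ?_ a, a, ha, fun c hc => ⟨hsub a ha hc, hmem a c hc⟩⟩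
  rintro _ ⟨B, hB, rfl⟩
  exact def_of_def_empty b (def_simSets h n B hB)

theorem exists_sim_of_def_family {n m : ℕ} (h : IsColorRefinement U 𝒰) {b : Fin m → S}
    {T : Set (Fin n → S)} {D : (Fin n → S) → Set S} (hD : Def U (Set.range b)
      {p : Fin (n + 1) → S | Fin.tail p ∈ T ∧ p 0 ∈ D (Fin.tail p)}) :
    ∃ N, ∀ a ∈ T, ∀ c ∈ T, ∀ x y,
      Sim U 𝒰 N (extend x (Sum.elim a b)) (extend y (Sum.elim c b)) → (x ∈ D a ↔ y ∈ D c) := by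
  obtain ⟨N, hN⟩ := exists_sim_of_def h hD
  refine ⟨N, fun a ha c hc x y hxy => ?_⟩
  let f : Fin (n + 1) ⊕ Fin m → Option (Fin n ⊕ Fin m) :=
    Sum.elim (Fin.cons none fun i => some (Sum.inl i)) fun i => some (Sum.inr i)
  have hf : ∀ (x : S) (a : Fin n → S), extend x (Sum.elim a b) ∘ f =
      Sum.elim (Fin.cons (α := fun _ => S) x a) b := by
    intro x a
    ext (i | i)
    · refine Fin.cases ?_ (fun i => ?_) i <;> simp [f, extend]
    · rfl
  have := hN (Fin.cons x a) (Fin.cons y c) (by rw [← hf, ← hf]; exact hxy.comp f)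
  simpa [ha, hc] using this

/-- The cell of `x` over `a`, as a family. -/
def cellFamily {κ : Type} (U : ι → Set S) (𝒰 : ℕ → Set (Set S)) (n : ℕ) (a : κ → S) (x : S)
    (c : κ → S) : Set S :=
  {y | SameCell U 𝒰 n x a y c}

theorem cellFamily_eq {κ : Type} {n : ℕ} {a : κ → S} {x y : S} (h : SameCell U 𝒰 n x a y a) :
    cellFamily U 𝒰 n a x = cellFamily U 𝒰 n a y := by
  ext c z
  exact ⟨h.symm.trans, h.trans⟩

/-- The cell depends only on the color of `x` and its position among finitely many values at `a`,
that is, on the atom of `x`. -/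
theorem finite_range_cellFamily {κ : Type} [Finite κ] (h : IsColorRefinement U 𝒰) (n : ℕ)
    (a : κ → S) : (Set.range (cellFamily U 𝒰 n a)).Finite := by
  have hc := finite_compBelow (U := U) (h.finite_colorsBelow n) (2 * n + 1)
  have hℬ := ((h.partition n).finite).union
    ((hc.image2 (fun F (π : Proj κ) => {x | F (π.eval U a) < toCut U x}) Set.finite_univ).union
      (hc.image2 (fun F (π : Proj κ) => {x | toCut U x < F (π.eval U a)}) Set.finite_univ))
  refine ((finite_range_atom hℬ).image fun A c => {y | ∃ x ∈ A, SameCell U 𝒰 n x a y c}).subset ?_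
  rintro _ ⟨x, rfl⟩
  refine ⟨_, ⟨x, rfl⟩, ?_⟩
  ext c y
  constructor
  · rintro ⟨x', hx', hy⟩
    refine SameCell.trans ⟨fun P hP => hx' P (Or.inl hP), fun k hk F hF π => ?_,
      fun k hk F hF π => ?_⟩ hy
    · exact hx' _ (Or.inr (Or.inl ⟨F, ⟨k, by omega, hF⟩, π, trivial, rfl⟩))
    · exact hx' _ (Or.inr (Or.inr ⟨F, ⟨k, by omega, hF⟩, π, trivial, rfl⟩))
  · exact fun hy => ⟨x, mem_atom_self x, hy⟩

/-- A set of points that is preserved by similarity is a disjoint union of cells, uniformly for all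
similar tuples. -/
theorem exists_disjoint_cells {κ : Type} [Finite κ] (h : IsColorRefinement U 𝒰) (n : ℕ) (a : κ → S)
    (D : Set S) : ∃ (k : ℕ) (C : Fin k → (κ → S) → Set S),
      (∀ j, IsCell U (allColors 𝒰) (C j)) ∧ ∀ c, Sim U 𝒰 (2 * n + 2) a c →
        Pairwise (fun i j => Disjoint (C i c) (C j c)) ∧
        ⋃ j, C j c = {y | ∃ x ∈ D, SameCell U 𝒰 n x a y c} := by
  have hfin := (finite_range_cellFamily h n a).subset (Set.image_subset_range _ D)
  have := hfin.to_subtype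
  obtain ⟨k, ⟨e⟩⟩ := Finite.exists_equiv_fin (cellFamily U 𝒰 n a '' D)
  -- One representative in `D` for each cell that meets `D`.
  choose x hxD hx using fun j => (e.symm j).2
  choose C hC hC' using fun j => exists_cell h n (x j) a
  refine ⟨k, C, hC, fun c hac => ⟨fun i j hij => ?_, ?_⟩⟩
  · beta_reduce
    rw [(hC' i c hac).1, (hC' j c hac).1]
    refine Set.disjoint_left.2 fun y hi hj => hij (e.symm.injective (Subtype.ext ?_))
    rw [← hx i, ← hx j]
    exact cellFamily_eq (SameCell.trans hi (SameCell.symm hj))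
  · ext y
    rw [Set.mem_iUnion]
    constructor
    · rintro ⟨j, hj⟩
      exact ⟨x j, hxD j, (hC' j c hac).1.subset hj⟩
    · rintro ⟨x', hx', hy⟩
      refine ⟨e ⟨_, x', hx', rfl⟩, (hC' _ c hac).1.superset ?_⟩
      have := hx (e ⟨_, x', hx', rfl⟩)
      rw [Equiv.symm_apply_apply] at this
      exact (congrFun this c).superset hy

/-- A singleton cell is the value of a composition of cut functions. -/
theorem IsCell.exists_eq {κ : Type} {𝒱 : Set (Set S)} (h𝒱 : ∀ V ∈ 𝒱, Def₁ U ∅ V)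
    {C : (κ → S) → Set S} (hC : IsCell U 𝒱 C) :
    ∃ F ∈ cutFunctions U 𝒱, ∃ π : Proj κ, ∀ c y, C c = {y} → toCut U y = F (π.eval U c) := by
  cases hC with
  | point hE π =>
    exact ⟨_, hE, π, fun c y hy => (hy.superset (Set.mem_singleton y) : _ = toCut U y).symm⟩
  | @interval L R hL hR π π' V hV =>
    obtain ⟨k, hL⟩ := hL
    -- The only point of `V` between `L` and `R` is the first point of `V` above `L`, namely
    -- `V₊(L)`.
    refine ⟨_, ⟨k + 1, hL.plus V hV (h𝒱 V hV)⟩, π, fun c y hy => ?_⟩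
    obtain ⟨hLy, hyR, hyV⟩ := hy.superset (Set.mem_singleton y)
    refine le_antisymm (not_lt.1 fun hlt => ?_) (cutPlus_le _ hyV hLy)
    obtain ⟨u, huV, hLu, huy⟩ := (cutPlus_lt_iff _).1 hlt
    have : u = y := hy.subset ⟨hLu, huy.trans hyR, huV⟩
    exact huy.ne (congrArg _ this)

/-- The domain is the projection of the graph. -/
theorem def_tail {A : Set S} {n : ℕ} {X : Set (Fin n → S)} {f : X → S}
    (hf : Def U A {p : Fin (n + 1) → S | ∃ h : Fin.tail p ∈ X, p 0 = f ⟨Fin.tail p, h⟩}) :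
    Def U A X := by
  let _ := colStructure U
  refine (congrArg (Def U A) ?_).mp (Set.Definable.image_comp (L := colLang ι) hf Fin.succ)
  ext a
  constructor
  · rintro ⟨p, ⟨hp, -⟩, rfl⟩
    exact hp
  · exact fun ha => ⟨Fin.cons (f ⟨a, ha⟩) a, ⟨ha, rfl⟩, rfl⟩

end ColoredOrder

open ColoredOrder
theorem mainTheorem7 {ι : Type*} [Finite ι] {S : Type*} [LinearOrder S] (U : ι → Set S) :
    (∃ 𝒰 : ℕ → Set (Set S), IsColorRefinement U 𝒰) ∧
    ∀ 𝒰 : ℕ → Set (Set S), IsColorRefinement U 𝒰 →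
      -- quantifier elimination
      (∀ (n : ℕ) (D : Set (Fin n → S)), Def U ∅ D →
        D ∈ BooleanSubalgebra.closure (basicSets U (allColors 𝒰) (Fin n))) ∧
      -- definable families of subsets of `S`
      (∀ (n m : ℕ) (b : Fin m → S) (T : Set (Fin n → S)) (D : (Fin n → S) → Set S),
        Def U (Set.range b) T →
        Def U (Set.range b) {p : Fin (n + 1) → S | Fin.tail p ∈ T ∧ p 0 ∈ D (Fin.tail p)} →
        ∃ 𝒬 : Set (Set (Fin n → S)), IsFinPartition 𝒬 T ∧
          ∀ P ∈ 𝒬, Def U (Set.range b) P ∧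
            ∃ (k : ℕ) (C : Fin k → (Fin n ⊕ Fin m → S) → Set S),
              (∀ j, IsCell U (allColors 𝒰) (C j)) ∧
              ∀ a ∈ P,
                Pairwise (fun i j => Disjoint (C i (Sum.elim a b)) (C j (Sum.elim a b))) ∧
                D a = ⋃ j, C j (Sum.elim a b)) ∧
      -- definable functions
      (∀ (n m : ℕ) (b : Fin m → S) (X : Set (Fin n → S)) (f : X → S),
        Def U (Set.range b) {p : Fin (n + 1) → S | ∃ h : Fin.tail p ∈ X, p 0 = f ⟨Fin.tail p, h⟩} →
        ∃ 𝒬 : Set (Set (Fin n → S)), IsFinPartition 𝒬 X ∧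
          ∀ P ∈ 𝒬, Def U (Set.range b) P ∧
            ∃ F ∈ cutFunctions U (allColors 𝒰), ∃ π : Proj (Fin n ⊕ Fin m),
              ∀ (a : Fin n → S) (h : a ∈ X), a ∈ P →
                toCut U (f ⟨a, h⟩) = F (π.eval U (Sum.elim a b))) := by
  refine ⟨exists_isColorRefinement U, fun 𝒰 h => ⟨fun n D hD => ?_, ?_, ?_⟩⟩
  · let _ := colStructure U
    obtain ⟨φ, rfl⟩ := Set.empty_definable_iff.1 hD
    exact (simInvariant_formula h φ).mem_closure h
  · intro n m b T D hT hD
    obtain ⟨N₁, hT⟩ := exists_sim_of_def h hT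
    obtain ⟨N, hN⟩ := exists_sim_of_def_family h hD
    -- Stage `N₁` keeps each class inside or outside `T`; stage `2 * N + 2` permits extension by a
    -- point with similarity at stage `N`, which decides membership in the family.
    obtain ⟨𝒬, h𝒬, hP⟩ := exists_sim_partition h b (n := max N₁ (2 * N + 2))
      fun a a' haa' => hT a a' (haa'.mono h (le_max_left _ _))
    refine ⟨𝒬, h𝒬, fun P hPQ => ⟨(hP P hPQ).1, ?_⟩⟩
    obtain ⟨a, ha, hac⟩ := (hP P hPQ).2
    -- The cells of the fiber over one representative `a` serve for the whole class.
    obtain ⟨k, C, hC, hC'⟩ := exists_disjoint_cells h N (Sum.elim a b) (D a)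
    refine ⟨k, C, hC, fun c hc => ?_⟩
    have hsim := (hac c hc).2.mono h (le_max_right N₁ (2 * N + 2))
    refine ⟨(hC' _ hsim).1, ?_⟩
    rw [(hC' _ hsim).2]
    ext y
    constructor
    · intro hy
      obtain ⟨x, hx⟩ := exists_sameCell h hsim.symm y
      exact ⟨x, (hN a ha c (hac c hc).1 x y (hx.symm.sim_extend h hsim)).2 hy, hx.symm⟩
    · rintro ⟨x, hx, hxy⟩
      exact (hN a ha c (hac c hc).1 x y (hxy.sim_extend h hsim)).1 hx
  · intro n m b X f hf
    obtain ⟨N₁, hX⟩ := exists_sim_of_def h (def_tail hf)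
    -- The function is treated as the family of singletons of its values, so the cell of `f(a)`,
    -- transported to `c`, can contain only `f(c)`.
    obtain ⟨N, hN⟩ := exists_sim_of_def_family h (T := X) (D := fun a => {y | ∃ h, y = f ⟨a, h⟩})
      ((congrArg (Def U (Set.range b)) (by ext p; simp)).mp hf)
    obtain ⟨𝒬, h𝒬, hP⟩ := exists_sim_partition h b (n := max N₁ (2 * N + 2))
      fun a a' haa' => hX a a' (haa'.mono h (le_max_left _ _))
    refine ⟨𝒬, h𝒬, fun P hPQ => ⟨(hP P hPQ).1, ?_⟩⟩
    obtain ⟨a, ha, hac⟩ := (hP P hPQ).2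
    obtain ⟨C, hC, hC'⟩ := exists_cell h N (f ⟨a, ha⟩) (Sum.elim a b)
    obtain ⟨F, hF, π, hFπ⟩ := hC.exists_eq fun V hV =>
      h.definable_colorsBelow V (exists_mem_colorsBelow hV).choose_spec
    refine ⟨F, hF, π, fun c hc hcP => hFπ _ _ ?_⟩
    have hsim := (hac c hcP).2.mono h (le_max_right N₁ (2 * N + 2))
    obtain ⟨hCc, hne⟩ := hC' _ hsim
    refine hne.subset_singleton_iff.1 fun y hy => ?_
    obtain ⟨_, hy⟩ := (hN a ha c hc _ y ((hCc.subset hy).sim_extend h hsim)).1 ⟨ha, rfl⟩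
    exact hy
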